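/- **Conditional fixing lemma.** *Setting.* Let $n$ and $c=\lfloor n^{1/7}\rfloor$ be powers of $2$, and let $p=n^{-4/7}$, $q=n^{-2/7}$. The nodes are the pairs $(i,x)$ with $0\le i,x<n$; node $(i,x)$ is on level $i$, and level $n-1$ is the bottom level. The propositional variables are: the $\log_2 n$ bits of a value $f_i(x)\in[0,n)$, for $i<n-1$ and $x<n$; a variable $G_i(x,y)$ ("node $(i,x)$ has colour $y$") for $i,x<n$ and $y<c$; and the $\log_2 c$ bits of a value $u(x)\in[0,c)$ for $x<n$. A *restriction* $\rho$ is a partial assignment to these variables in which, for each value $f_i(x)$ or $u(x)$, either all bits or no bits are set. A *path* of $\rho$ is a maximal sequence of nodes $(i,x_0),\dots,(i+l,x_l)$ with $f_{i+j}(x_j)=x_{j+1}$ in $\rho$ for $0\le j<l$ (possibly a single node). *Random restrictions.* $\mathcal R_{p,q}$ is the following distribution. Include each pair $(i,x)$ with $i<n-1$, $x<n$ in a set $Z$ independently with probability $1-p$. For each $i<n-1$ independently choose $f_i$ uniformly among the injections from $\{x:(i,x)\in Z\}$ to $[0,n)$. Set $G_i(x,y)=0$ for all $y$ and all nodes $(i,x)$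 on the path through $(0,0)$. For every other path independently, with probability $1-q$ choose a uniformly random colour $y$ and set $G_i(x,y)=1$ and $G_i(x,y')=0$ for all $y'\ne y$, for all nodes $(i,x)$ on the path; otherwise set no $G$-variables on it. If a node $(n-1,x)$ is on a path that received a colour $y$ in this way, set $u(x)=y$; otherwise leave $u(x)$ unset. All probabilities are over $\rho\sim\mathcal R_{p,q}$. *Legal and good.* A restriction is *legal* if every $f_i$ is a partial injection and every path $\pi$ is of one of three kinds: (1) no $G_i(x,y)$ is set for any node $(i,x)$ on $\pi$, and no $u(x)$ is set for $(n-1,x)$ on $\pi$; (2) $\pi$ contains $(0,0)$, does not reach the bottom level, and $G_i(x,y)=0$ for all $y$ and all $(i,x)$ on $\pi$; (3) $\pi$ does not contain $(0,0)$, and there is a colour $y$ such that $G_i(x,y)=1$ and $G_i(x,y')=0$ for all $y'\neq y$ and all $(i,x)$ on $\pi$, and $u(x)=y$ if $(n-1,x)$ is on $\pi$. Fix a real constant $K>1$. A restriction is *good* if it is legal and of typical size: no path has more than $K n^{5/7}$ nodes; for every $i<n-1$ the number of $x$ with $f_i(x)$ unset is between $pn/K$ and $Kpn$; and every level contains at least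 $pqn/K$ nodes that are the first node of a path and have none of their $G$-variables set. It is *bad* if it is not good. *Fixing.* A $k$-CNF is a conjunction of clauses with at most $k$ literals each. A restriction *falsifies* a CNF if it sets all literals of some clause to $0$. A restriction $\rho$ *fixes* $B$ *to* $0$ if it falsifies $B$, it fixes $B$ *to* $1$ if no legal extension of $\rho$ falsifies $B$, and it *fixes* $B$ if it fixes $B$ to $0$ or to $1$. *Statement.* For every $K>1$ there is $n_0$ such that for all $n\ge n_0$ as above the following holds for every $k\ge 1$. Let $A_1,\dots,A_m$ be $k$-CNFs and $e_1,\dots,e_m\in\{0,1\}$ such that $$\Pr[\rho\text{ is bad}\mid\rho\text{ fixes each }A_i\text{ to }e_i]<\tfrac12 .$$ Then for every $k$-CNF $B$, $$\Pr[\rho\text{ does not fix }B\mid\rho\text{ is good and }\rho\text{ fixes each }A_i\text{ to }e_i]<12\,k\,n^{-1/7}.$$ -/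

import Mathlib

open scoped ENNReal NNReal

noncomputable section

namespace CPLS

/-! ### Variables, restrictions, CNFs -/

/-- The node `(i, x)` is node `x` on level `i`. -/
abbrev Node (a b : ℕ) : Type := Fin a × Fin b

/-- The propositional variables: the bits of the values `f_i(x)` (for `i < a - 1`), the
predicates `G_i(x, y)`, and the bits of the values `u(x)`. -/
inductive Var (a b c : ℕ) : Type
  | fBit (i : Fin (a - 1)) (x : Fin b) (j : Fin (Nat.log 2 b))
  | col (i : Fin a) (x : Fin b) (y : Fin c)
  | uBit (x : Fin b) (j : Fin (Nat.log 2 c))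

/-- The functions `f_i`, each of them partial. -/
abbrev Edges (a b : ℕ) : Type := Fin (a - 1) → Fin b → Option (Fin b)

/-- A restriction (partial oracle). For each value `f_i(x)` or `u(x)`, either all of its bits are
set or none of them is. -/
structure Restriction (a b c : ℕ) : Type where
  /-- `f i x` is the value of `f_i(x)`, or `none` if it is unset. -/
  f : Edges a b
  /-- `G i x y` is the truth value of `G_i(x, y)`, or `none` if it is unset. -/
  G : Fin a → Fin b → Fin c → Option Bool
  /-- `u x` is the value of `u(x)`, or `none` if it is unset. -/
  u : Fin b → Option (Fin c)

variable {a b c : ℕ}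

/-- The truth value that a restriction gives to a propositional variable, if any. -/
def Restriction.value (ρ : Restriction a b c) : Var a b c → Option Bool
  | .fBit i x j => (ρ.f i x).map fun z => z.val.testBit j.val
  | .col i x y => ρ.G i x y
  | .uBit x j => (ρ.u x).map fun z => z.val.testBit j.val

/-- `σ` extends `ρ`: everything that is set in `ρ` is set in `σ`, to the same value. -/
def Extends (σ ρ : Restriction a b c) : Prop :=
  (∀ i x z, ρ.f i x = some z → σ.f i x = some z) ∧
  (∀ i x y t, ρ.G i x y = some t → σ.G i x y = some t) ∧
  (∀ x y, ρ.u x = some y → σ.u x = some y)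

/-- The literal `(v, s)` says that the variable `v` has truth value `s`. -/
abbrev Literal (a b c : ℕ) : Type := Var a b c × Bool

/-- A clause is a finite disjunction of literals. -/
abbrev Clause (a b c : ℕ) : Type := Finset (Literal a b c)

/-- A CNF is a finite conjunction of clauses. -/
abbrev CNF (a b c : ℕ) : Type := Finset (Clause a b c)

/-- Every clause contains at most `k` literals. -/
def IsKCNF (k : ℕ) (B : CNF a b c) : Prop := ∀ D ∈ B, D.card ≤ k

/-- Some clause of `B` has all its literals set to `0` by `ρ`. -/
def Falsifies (ρ : Restriction a b c) (B : CNF a b c) : Prop :=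
  ∃ D ∈ B, ∀ l ∈ D, ρ.value l.1 = some (!l.2)

/-! ### Paths, legal restrictions, fixing -/

/-- There is an edge from `(i, x)` to `(i + 1, f_i(x))`. -/
def Step (f : Edges a b) (v w : Node a b) : Prop :=
  ∃ i : Fin (a - 1), v.1.val = i.val ∧ w.1.val = i.val + 1 ∧ f i v.2 = some w.2

/-- `w` is reached from `v` along edges. -/
def Reach (f : Edges a b) : Node a b → Node a b → Prop := Relation.ReflTransGen (Step f)

/-- The set of nodes of the maximal path through `v`. (If the `f_i` are injective, then every node
has at most one incoming and at most one outgoing edge, and it is on exactly one path.) -/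
def pathOf (f : Edges a b) (v : Node a b) : Set (Node a b) := {w | Reach f v w ∨ Reach f w v}

/-- `v` is the node `(0, 0)`. -/
def IsOrigin (v : Node a b) : Prop := v.1.val = 0 ∧ v.2.val = 0

/-- `v` is on the bottom level `a - 1`. -/
def IsBottom (v : Node a b) : Prop := v.1.val + 1 = a

/-- No `G`-variable is set on the nodes of `π`, and no value `u(x)` either. -/
def PathUnset (ρ : Restriction a b c) (π : Set (Node a b)) : Prop :=
  ∀ v ∈ π, (∀ y, ρ.G v.1 v.2 y = none) ∧ (IsBottom v → ρ.u v.2 = none)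

/-- `π` goes through `(0, 0)`, does not reach the bottom level, and no node on it has a colour. -/
def PathZero (ρ : Restriction a b c) (π : Set (Node a b)) : Prop :=
  (∃ v ∈ π, IsOrigin v) ∧ ∀ v ∈ π, ¬ IsBottom v ∧ ∀ y, ρ.G v.1 v.2 y = some false

/-- `π` does not go through `(0, 0)`, all nodes on it have the same single colour `y`, and `u`
takes the value `y` at the end of `π` if `π` reaches the bottom level. -/
def PathOneColour (ρ : Restriction a b c) (π : Set (Node a b)) : Prop :=
  (∀ v ∈ π, ¬ IsOrigin v) ∧
    ∃ y, ∀ v ∈ π, (∀ y', ρ.G v.1 v.2 y' = some (decide (y' = y))) ∧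
      (IsBottom v → ρ.u v.2 = some y)

/-- Legal restrictions. -/
structure IsLegal (ρ : Restriction a b c) : Prop where
  inj : ∀ i x x' z, ρ.f i x = some z → ρ.f i x' = some z → x = x'
  path : ∀ v : Node a b, PathUnset ρ (pathOf ρ.f v) ∨ PathZero ρ (pathOf ρ.f v) ∨
    PathOneColour ρ (pathOf ρ.f v)

/-- `ρ` fixes `B` to `0` (`false`) if it falsifies `B`, and to `1` (`true`) if no legal extension
of `ρ` falsifies `B`. -/
def FixesTo (ρ : Restriction a b c) (B : CNF a b c) : Bool → Prop
  | false => Falsifies ρ B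
  | true => ∀ σ : Restriction a b c, IsLegal σ → Extends σ ρ → ¬ Falsifies σ B

/-- `ρ` fixes `B` to some truth value. -/
def Fixes (ρ : Restriction a b c) (B : CNF a b c) : Prop := ∃ e, FixesTo ρ B e

/-! ### Random restrictions -/

/-- Independent choices, the one with index `i` according to `μ i`. -/
def piPMF {ι : Type*} [Fintype ι] {α : ι → Type*} [∀ i, Fintype (α i)]
    (μ : ∀ i, PMF (α i)) : PMF (∀ i, α i) := by
  classical
  exact PMF.ofFintype (fun g => ∏ i, μ i (g i)) (by
    rw [← Fintype.prod_sum]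
    refine Finset.prod_eq_one fun i _ => ?_
    have h := (μ i).tsum_coe
    rwa [tsum_fintype] at h)

/-- A coin that shows `false` with probability `r` and `true` with probability `1 - r`. -/
def coin (r : ℝ≥0) (hr : r ≤ 1) : PMF Bool :=
  PMF.ofFintype (fun t => if t then ((1 - r : ℝ≥0) : ℝ≥0∞) else (r : ℝ≥0∞)) (by
    rw [Fintype.sum_bool]
    simp only [if_true, Bool.false_eq_true, if_false]
    rw [← ENNReal.coe_add, tsub_add_cancel_of_le hr, ENNReal.coe_one])

instance (Z : Fin b → Bool) : Nonempty ({x // Z x = true} ↪ Fin b) :=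
  ⟨Function.Embedding.subtype _⟩

/-- One function `f_i`: include each `x` in the domain `Z` independently with probability `1 - p`,
then choose a uniformly random injection from `Z` into `[0, b)`. -/
def randomInjection (b : ℕ) (p : ℝ≥0) (hp : p ≤ 1) : PMF (Fin b → Option (Fin b)) :=
  (piPMF fun _ : Fin b => coin p hp).bind fun Z =>
    (PMF.uniformOfFintype ({x // Z x = true} ↪ Fin b)).map fun g x =>
      if h : Z x = true then some (g ⟨x, h⟩) else none

/-- The colour of one path: with probability `1 - q` a uniformly random colour, otherwise none. -/
def randomColour (c : ℕ) [NeZero c] (q : ℝ≥0) (hq : q ≤ 1) : PMF (Option (Fin c)) :=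
  (coin q hq).bind fun t =>
    if t then (PMF.uniformOfFintype (Fin c)).map some else PMF.pure none

/-- The paths that do not go through `(0, 0)`. -/
abbrev OtherPath (f : Edges a b) : Type :=
  {π : Set (Node a b) // (∃ v, π = pathOf f v) ∧ ∀ v ∈ π, ¬ IsOrigin v}

instance (f : Edges a b) : Fintype (OtherPath f) := Fintype.ofFinite _

open Classical in
/-- The colour that the choices `κ` give to the path through `v`, if any. -/
def colourAt (f : Edges a b) (κ : OtherPath f → Option (Fin c)) (v : Node a b) :
    Option (Fin c) :=
  if h : ∀ w ∈ pathOf f v, ¬ IsOrigin w then κ ⟨pathOf f v, ⟨v, rfl⟩, h⟩ else none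

open Classical in
/-- The restriction given by the functions `f_i` and by colours for the paths that do not go
through `(0, 0)`. On the path through `(0, 0)` all `G_i(x, y)` are `0`. -/
def ofColouring (f : Edges a b) (κ : OtherPath f → Option (Fin c)) : Restriction a b c where
  f := f
  G i x y :=
    if ∃ w ∈ pathOf f (i, x), IsOrigin w then some false
    else (colourAt f κ (i, x)).map fun z => decide (y = z)
  u x := if h : 0 < a then colourAt f κ (⟨a - 1, Nat.sub_lt h Nat.one_pos⟩, x) else none

/-- The distribution `R_{p,q}` of random restrictions. -/
def randomRestriction (a b c : ℕ) [NeZero c] (p q : ℝ≥0) (hp : p ≤ 1) (hq : q ≤ 1) :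
    PMF (Restriction a b c) :=
  (piPMF fun _ : Fin (a - 1) => randomInjection b p hp).bind fun f =>
    (piPMF fun _ : OtherPath f => randomColour c q hq).map (ofColouring f)

instance : MeasurableSpace (Restriction a b c) := ⊤

/-! ### The choice of parameters, good restrictions -/

/-- `p = n ^ (-4/7)` -/
def pPar (n : ℕ) : ℝ≥0 := (n : ℝ≥0) ^ (-(4 / 7) : ℝ)

/-- `q = n ^ (-2/7)` -/
def qPar (n : ℕ) : ℝ≥0 := (n : ℝ≥0) ^ (-(2 / 7) : ℝ)

theorem natCast_rpow_le_one (n : ℕ) {s : ℝ} (hs : s < 0) : (n : ℝ≥0) ^ s ≤ 1 := by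
  rcases Nat.eq_zero_or_pos n with h | h
  · subst h
    simp [NNReal.zero_rpow hs.ne]
  · exact NNReal.rpow_le_one_of_one_le_of_nonpos (by exact_mod_cast h) hs.le

theorem pPar_le_one (n : ℕ) : pPar n ≤ 1 := natCast_rpow_le_one n (by norm_num)

theorem qPar_le_one (n : ℕ) : qPar n ≤ 1 := natCast_rpow_le_one n (by norm_num)

/-- The probability measure `R_{p,q}` for `a = b = n`, `p = n ^ (-4/7)` and `q = n ^ (-2/7)`. -/
def law (n c : ℕ) [NeZero c] : MeasureTheory.Measure (Restriction n n c) :=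
  (randomRestriction n n c (pPar n) (qPar n) (pPar_le_one n) (qPar_le_one n)).toMeasure

/-- Good restrictions: legal ones of typical size, where `K > 1` is the tolerance. No path has more
than `K n ^ (5/7)` nodes; for each `i` the number of `x` for which `f_i(x)` is unset is within a
factor `K` of its mean `p n`; and on each level at least `p q n / K` nodes are the first node of a
path on which no colour is set. -/
structure IsGood {n c : ℕ} (K : ℝ) (ρ : Restriction n n c) : Prop where
  legal : IsLegal ρ
  short : ∀ v : Node n n, ((pathOf ρ.f v).ncard : ℝ) ≤ K * (n : ℝ) ^ (5 / 7 : ℝ)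
  unset_ge : ∀ i : Fin (n - 1), (pPar n : ℝ) * n / K ≤ ({x | ρ.f i x = none} : Set (Fin n)).ncard
  unset_le : ∀ i : Fin (n - 1), (({x | ρ.f i x = none} : Set (Fin n)).ncard : ℝ) ≤ K * (pPar n * n)
  free_ge : ∀ i : Fin n, (pPar n : ℝ) * qPar n * n / K ≤
    ({x | (∀ w, ¬ Step ρ.f w (i, x)) ∧ ∀ y, ρ.G i x y = none} : Set (Fin n)).ncard

end CPLS

end

open scoped ENNReal NNReal

noncomputable section

namespace CPLS

variable {a b c : ℕ}

/-! Write N = n^{1/7}, so that p = N^{-4}, q = N^{-2} and c ≤ N. Let s be good, fix every A_i to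
e_i, and not fix B. Some legal extension of s falsifies a clause of B; let D be the first such
clause in a fixed order. Setting only variables of D already turns s into a legal t that falsifies D
(`exists_extension`), and t still fixes every A_i to e_i, since fixing survives extension.
Conversely t determines D as the first clause of B that t falsifies: every clause falsified by t was
a candidate for s. So s comes from t by undoing at most k settings of known variables.

Undoing is improbable. The states from which t arises by setting one given variable have total
weight at most δ = 2/N times the weight of t (`sum_varStep_le`). Colouring a path replaces a factor
q by (1-q)/c, a ratio of about qc ≤ 1/N. Setting f_i(x) while at most Kpn values on its level are
unset has ratio at most Kp²n/(1-p), of order K/N, and joining two paths into one loses a further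
colour factor of order 1/N, which absorbs K and the four possible predecessors. Over the variables
of D, with s = t excluded, the factor is (1+δ)^k - 1 ≤ 4k/N (`sum_not_fixes_le`,
`law_real_not_fixes_le`).

Hence Pr[good, all A_i fixed, B not fixed] ≤ (4k/N) Pr[all A_i fixed]. The hypothesis on bad
restrictions makes the last probability less than 2 Pr[good, all A_i fixed], which leaves 8k/N. If
12k > N, the claim is trivial. -/

/-! ### Paths of partial injections and their first nodes -/

/-- Each `f_i` is injective. -/
def InjEdges (f : Edges a b) : Prop :=
  ∀ i x x' z, f i x = some z → f i x' = some z → x = x'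

/-- `v` is the first node of a path. -/
def IsStart (f : Edges a b) (v : Node a b) : Prop := ∀ w, ¬ Step f w v

/-- The path through `v` goes through `(0, 0)`. -/
def OnOrigin (f : Edges a b) (v : Node a b) : Prop := ∃ w ∈ pathOf f v, IsOrigin w

theorem Step.right_unique {f : Edges a b} {v w w' : Node a b} (h : Step f v w)
    (h' : Step f v w') : w = w' := by
  obtain ⟨i, h1, h2, h3⟩ := h
  obtain ⟨j, h1', h2', h3'⟩ := h'
  have : i = j := Fin.ext (h1.symm.trans h1')
  subst this
  rw [h3] at h3'
  exact Prod.ext (Fin.ext (by omega)) (Option.some.inj h3')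

theorem Step.left_unique {f : Edges a b} (hf : InjEdges f) {v v' w : Node a b} (h : Step f v w)
    (h' : Step f v' w) : v = v' := by
  obtain ⟨i, h1, h2, h3⟩ := h
  obtain ⟨j, h1', h2', h3'⟩ := h'
  have : i = j := Fin.ext (by omega)
  subst this
  exact Prod.ext (Fin.ext (by omega)) (hf _ _ _ _ h3 h3')

theorem Step.level {f : Edges a b} {v w : Node a b} (h : Step f v w) :
    w.1.val = v.1.val + 1 := by
  obtain ⟨i, h1, h2, h3⟩ := h
  omega

theorem reach_total_right {f : Edges a b} {u v w : Node a b} (h : Reach f u v)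
    (h' : Reach f u w) : Reach f v w ∨ Reach f w v :=
  Relation.ReflTransGen.total_of_right_unique (fun _ _ _ h1 h2 => h1.right_unique h2) h h'

theorem reach_total_left {f : Edges a b} (hf : InjEdges f) {u v w : Node a b} (h : Reach f v u)
    (h' : Reach f w u) : Reach f v w ∨ Reach f w v := by
  have := Relation.ReflTransGen.total_of_right_unique (r := Function.swap (Step f))
    (fun _ _ _ h1 h2 => h1.left_unique hf h2) h.swap h'.swap
  rcases this with h | h
  · exact Or.inr h.swap
  · exact Or.inl h.swap

theorem mem_pathOf_self (f : Edges a b) (v : Node a b) : v ∈ pathOf f v :=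
  Or.inl Relation.ReflTransGen.refl

theorem mem_pathOf_symm {f : Edges a b} {v w : Node a b} (h : w ∈ pathOf f v) :
    v ∈ pathOf f w := Or.symm h

/-- Forward steps are unique for any functions, backward steps only by injectivity; together they
make nodes with a common ancestor or descendant comparable. -/
theorem mem_pathOf_trans {f : Edges a b} (hf : InjEdges f) {u v w : Node a b}
    (h : v ∈ pathOf f u) (h' : w ∈ pathOf f v) : w ∈ pathOf f u := by
  rcases h with h | h <;> rcases h' with h' | h'
  · exact Or.inl (h.trans h')
  · exact reach_total_left hf h h'
  · exact reach_total_right h h'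
  · exact Or.inr (h'.trans h)

theorem pathOf_eq {f : Edges a b} (hf : InjEdges f) {v w : Node a b} (h : w ∈ pathOf f v) :
    pathOf f w = pathOf f v :=
  Set.ext fun _ => ⟨fun h' => mem_pathOf_trans hf h h',
    fun h' => mem_pathOf_trans hf (mem_pathOf_symm h) h'⟩

theorem Step.mem_pathOf {f : Edges a b} {v w : Node a b} (h : Step f v w) : w ∈ pathOf f v :=
  Or.inl (Relation.ReflTransGen.single h)

theorem onOrigin_congr {f : Edges a b} (hf : InjEdges f) {v w : Node a b} (h : w ∈ pathOf f v) :
    OnOrigin f w ↔ OnOrigin f v := by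
  unfold OnOrigin
  rw [pathOf_eq hf h]

theorem IsOrigin.onOrigin (f : Edges a b) {v : Node a b} (h : IsOrigin v) : OnOrigin f v :=
  ⟨v, mem_pathOf_self f v, h⟩

theorem IsOrigin.isStart (f : Edges a b) {v : Node a b} (h : IsOrigin v) : IsStart f v :=
  fun w hw => by have := hw.level; have := h.1; omega

theorem exists_start_reach (f : Edges a b) (v : Node a b) : ∃ s, IsStart f s ∧ Reach f s v := by
  obtain ⟨d, hd⟩ : ∃ d, v.1.val = d := ⟨_, rfl⟩
  induction d using Nat.strong_induction_on generalizing v with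
  | _ d ih =>
    by_cases hs : IsStart f v
    · exact ⟨v, hs, Relation.ReflTransGen.refl⟩
    · unfold IsStart at hs
      push Not at hs
      obtain ⟨w, hw⟩ := hs
      have := hw.level
      obtain ⟨s, h1, h2⟩ := ih _ (by omega) w rfl
      exact ⟨s, h1, h2.tail hw⟩

theorem IsStart.eq_of_reach {f : Edges a b} {v w : Node a b} (h : IsStart f w)
    (hr : Reach f v w) : v = w := by
  rcases Relation.ReflTransGen.cases_tail hr with h1 | ⟨u, _, h2⟩
  · exact h1.symm
  · exact absurd h2 (h u)

theorem IsStart.eq_of_mem {f : Edges a b} {v w : Node a b} (hv : IsStart f v) (hw : IsStart f w)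
    (h : w ∈ pathOf f v) : v = w := by
  rcases h with h | h
  · exact hw.eq_of_reach h
  · exact (hv.eq_of_reach h).symm

theorem exists_start (f : Edges a b) (v : Node a b) : ∃ s, IsStart f s ∧ s ∈ pathOf f v := by
  obtain ⟨s, h1, h2⟩ := exists_start_reach f v
  exact ⟨s, h1, Or.inr h2⟩

/-! ### Colourings of paths as colourings of nodes -/

/-- A colouring of the nodes which is constant on paths and leaves `(0, 0)` uncoloured. -/
structure Valid (f : Edges a b) (κ : Node a b → Option (Fin c)) : Prop where
  inj : InjEdges f
  step : ∀ v w, Step f v w → κ v = κ w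
  origin : ∀ v, IsOrigin v → κ v = none

theorem Valid.reach {f : Edges a b} {κ : Node a b → Option (Fin c)} (h : Valid f κ)
    {v w : Node a b} (hr : Reach f v w) : κ v = κ w := by
  induction hr with
  | refl => rfl
  | tail _ h2 ih => exact ih.trans (h.step _ _ h2)

theorem Valid.path {f : Edges a b} {κ : Node a b → Option (Fin c)} (h : Valid f κ)
    {v w : Node a b} (hr : w ∈ pathOf f v) : κ w = κ v := by
  rcases hr with h1 | h1
  · exact (h.reach h1).symm
  · exact h.reach h1

theorem Valid.eq_none {f : Edges a b} {κ : Node a b → Option (Fin c)} (h : Valid f κ)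
    {v : Node a b} (hv : OnOrigin f v) : κ v = none := by
  obtain ⟨w, h1, h2⟩ := hv
  rw [← h.path h1, h.origin w h2]

open Classical in
/-- The restriction given by the functions `f_i` and a colouring of the nodes. -/
def toRestriction (f : Edges a b) (κ : Node a b → Option (Fin c)) : Restriction a b c where
  f := f
  G i x y := if OnOrigin f (i, x) then some false else (κ (i, x)).map fun z => decide (y = z)
  u x := if h : 0 < a then κ (⟨a - 1, Nat.sub_lt h Nat.one_pos⟩, x) else none

theorem ofColouring_eq (f : Edges a b) (κ : OtherPath f → Option (Fin c)) :
    ofColouring f κ = toRestriction f (colourAt f κ) := by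
  unfold ofColouring toRestriction OnOrigin
  congr 1
  funext i x y
  congr

theorem colourAt_apply (f : Edges a b) (κ : OtherPath f → Option (Fin c)) (π : OtherPath f)
    {v : Node a b} (hv : π.1 = pathOf f v) : colourAt f κ v = κ π := by
  obtain ⟨π, h1, h2⟩ := π
  subst hv
  exact dif_pos h2

theorem colourAt_valid {f : Edges a b} (hf : InjEdges f) (κ : OtherPath f → Option (Fin c)) :
    Valid f (colourAt f κ) where
  inj := hf
  step v w h := by
    have h1 := pathOf_eq hf h.mem_pathOf
    by_cases hv : ∀ w ∈ pathOf f v, ¬ IsOrigin w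
    · rw [colourAt_apply f κ ⟨pathOf f v, ⟨v, rfl⟩, hv⟩ rfl,
        colourAt_apply f κ ⟨pathOf f v, ⟨v, rfl⟩, hv⟩ h1.symm]
    · unfold colourAt
      rw [dif_neg hv, dif_neg (by rwa [h1])]
  origin v h := by
    unfold colourAt
    rw [dif_neg]
    intro h'
    exact h' v (mem_pathOf_self f v) h

theorem colourAt_injective (f : Edges a b) :
    Function.Injective (colourAt f : (OtherPath f → Option (Fin c)) → _) := by
  intro κ κ' h
  funext π
  obtain ⟨v, hv⟩ := π.2.1
  rw [← colourAt_apply f κ π hv, ← colourAt_apply f κ' π hv, h]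

/-- With `colourAt_injective` and `colourAt_valid` this makes colour choices for paths the same
thing as valid node colourings, which remain comparable when the edges change. -/
theorem exists_colourAt {f : Edges a b} {κ : Node a b → Option (Fin c)} (h : Valid f κ) :
    ∃ κ' : OtherPath f → Option (Fin c), colourAt f κ' = κ := by
  refine ⟨fun π => κ π.2.1.choose, ?_⟩
  funext v
  by_cases hv : ∀ w ∈ pathOf f v, ¬ IsOrigin w
  · rw [colourAt_apply f _ ⟨pathOf f v, ⟨v, rfl⟩, hv⟩ rfl]
    apply h.path
    have := (⟨v, rfl⟩ : ∃ v', pathOf f v = pathOf f v').choose_spec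
    exact this.symm.subset (mem_pathOf_self _ _)
  · unfold colourAt
    rw [dif_neg hv]
    push Not at hv
    exact (h.eq_none hv).symm

theorem OnOrigin.of_isStart {f : Edges a b} {v : Node a b} (hv : IsStart f v)
    (h : OnOrigin f v) : IsOrigin v := by
  obtain ⟨w, h1, h2⟩ := h
  rwa [hv.eq_of_mem (h2.isStart f) h1]

open Classical in
/-- Other paths correspond to their first nodes. -/
theorem prod_otherPath {M : Type*} [CommMonoid M] {f : Edges a b} (hf : InjEdges f)
    (κ : OtherPath f → Option (Fin c)) (g : Option (Fin c) → M) :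
    ∏ π, g (κ π) =
      ∏ v ∈ Finset.univ.filter (IsStart f), if IsOrigin v then 1 else g (colourAt f κ v) := by
  rw [← Finset.prod_filter_mul_prod_filter_not _ (fun v : Node a b => IsOrigin v),
    Finset.prod_eq_one (s := Finset.filter _ (Finset.filter _ _)), one_mul]
  swap
  · intro v hv
    rw [if_pos (Finset.mem_filter.1 hv).2]
  symm
  refine Finset.prod_bij (fun v hv => ⟨pathOf f v, ⟨v, rfl⟩, fun w hw ho => ?_⟩) ?_ ?_ ?_ ?_
  · simp only [Finset.mem_filter, Finset.mem_univ, true_and] at hv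
    exact hv.2 (OnOrigin.of_isStart hv.1 ⟨w, hw, ho⟩)
  · simp
  · intro v hv w hw h
    simp only [Finset.mem_filter, Finset.mem_univ, true_and] at hv hw
    have h' : pathOf f v = pathOf f w := congrArg Subtype.val h
    exact hv.1.eq_of_mem hw.1 (by rw [h']; exact mem_pathOf_self _ _)
  · rintro ⟨π, ⟨v, rfl⟩, h2⟩ _
    obtain ⟨s, hs, hm⟩ := exists_start f v
    refine ⟨s, ?_, ?_⟩
    · simp only [Finset.mem_filter, Finset.mem_univ, true_and]
      exact ⟨hs, h2 s hm⟩
    · exact Subtype.ext (pathOf_eq hf hm)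
  · intro v hv
    simp only [Finset.mem_filter, Finset.mem_univ, true_and] at hv
    rw [if_neg hv.2]
    congr 1
    exact colourAt_apply f κ _ rfl

/-! ### Point probabilities and the law as a weighted sum -/

theorem piPMF_apply {ι : Type*} [Fintype ι] {α : ι → Type*} [∀ i, Fintype (α i)]
    (μ : ∀ i, PMF (α i)) (g : ∀ i, α i) : piPMF μ g = ∏ i, μ i (g i) := by
  unfold piPMF
  rfl

theorem coin_toReal (r : ℝ≥0) (hr : r ≤ 1) (t : Bool) :
    (coin r hr t).toReal = if t then 1 - (r : ℝ) else r := by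
  unfold coin
  rw [PMF.ofFintype_apply]
  cases t
  · simp
  · simp only [if_true]
    rw [ENNReal.coe_toReal, NNReal.coe_sub hr, NNReal.coe_one]

theorem randomColour_none (c : ℕ) [NeZero c] (q : ℝ≥0) (hq : q ≤ 1) :
    (randomColour c q hq none).toReal = q := by
  unfold randomColour
  rw [PMF.bind_apply, tsum_fintype, Fintype.sum_bool]
  have h := coin_toReal q hq false
  simp only [Bool.false_eq_true, if_false, if_true] at h ⊢
  rw [PMF.map_apply]
  simp [h]

theorem randomColour_some (c : ℕ) [NeZero c] (q : ℝ≥0) (hq : q ≤ 1) (y : Fin c) :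
    (randomColour c q hq (some y)).toReal = (1 - q) / c := by
  unfold randomColour
  rw [PMF.bind_apply, tsum_fintype, Fintype.sum_bool]
  have h := coin_toReal q hq true
  simp only [Bool.false_eq_true, if_false, if_true] at h ⊢
  rw [PMF.map_apply, tsum_fintype]
  simp [h, div_eq_mul_inv]

-- A partial function determines its domain, and on that domain at most one embedding induces it, so
-- a single term of each sum survives.
open Classical in
theorem randomInjection_apply (b : ℕ) (p : ℝ≥0) (hp : p ≤ 1) (g : Fin b → Option (Fin b)) :
    (randomInjection b p hp g).toReal =
      if ∀ x x' z, g x = some z → g x' = some z → x = x' then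
        (∏ x, if (g x).isSome then 1 - (p : ℝ) else p) *
          ((b.descFactorial (Finset.univ.filter fun x => (g x).isSome = true).card : ℕ) : ℝ)⁻¹
      else 0 := by
  unfold randomInjection
  rw [PMF.bind_apply, tsum_fintype, Finset.sum_eq_single (fun x => (g x).isSome)]
  rotate_left
  · intro Z _ hZ
    rw [mul_eq_zero]
    right
    rw [PMF.map_apply, tsum_fintype]
    refine Finset.sum_eq_zero fun e _ => ?_
    rw [if_neg]
    rintro rfl
    apply hZ
    funext x
    by_cases h : Z x = true <;> simp [h]
  · simp
  rw [piPMF_apply, ENNReal.toReal_mul, ENNReal.toReal_prod]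
  simp only [coin_toReal]
  rw [PMF.map_apply, tsum_fintype]
  simp only [PMF.uniformOfFintype_apply]
  split_ifs with hg
  · congr 1
    let e : {x // (g x).isSome = true} ↪ Fin b :=
      ⟨fun x => (g x.1).get x.2, fun x y hxy => Subtype.ext (hg _ _ ((g x.1).get x.2)
        (by simp) (by simp only at hxy; rw [hxy]; simp))⟩
    have he : ∀ x, g x.1 = some (e x) := fun x => (Option.some_get x.2).symm
    rw [Finset.sum_eq_single e]
    · rw [if_pos, ENNReal.toReal_inv, ENNReal.toReal_natCast, Fintype.card_embedding_eq,
        Fintype.card_fin, Fintype.card_subtype]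
      funext x
      by_cases h : (g x).isSome = true
      · rw [dif_pos h]
        exact he ⟨x, h⟩
      · rw [dif_neg h]
        simpa using h
    · intro e' _ he'
      rw [if_neg]
      intro h
      apply he'
      ext x
      have h1 := congrFun h x.1
      rw [dif_pos x.2] at h1
      exact congrArg Fin.val (Option.some.inj (h1.symm.trans (he x)))
    · simp
  · rw [mul_eq_zero]
    right
    rw [Finset.sum_eq_zero, ENNReal.toReal_zero]
    intro e _
    rw [if_neg]
    intro h
    apply hg
    intro x x' z hx hx'
    have h1 : ∀ x, g x = some z → ∃ h : (g x).isSome = true, e ⟨x, h⟩ = z := by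
      intro x hx
      have h2 : (g x).isSome = true := by simp [hx]
      have h3 := congrFun h x
      rw [dif_pos h2] at h3
      exact ⟨h2, Option.some.inj (h3.symm.trans hx)⟩
    obtain ⟨h2, h3⟩ := h1 x hx
    obtain ⟨h2', h3'⟩ := h1 x' hx'
    exact congrArg Subtype.val (e.injective (h3.trans h3'.symm))

open Classical in
/-- The probability of `toRestriction f κ`, for a valid `κ`. -/
def weight [NeZero c] (p q : ℝ≥0) (hp : p ≤ 1) (hq : q ≤ 1) (f : Edges a b)
    (κ : Node a b → Option (Fin c)) : ℝ :=
  (∏ i, (randomInjection b p hp (f i)).toReal) *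
    ∏ v ∈ Finset.univ.filter (IsStart f),
      if IsOrigin v then 1 else (randomColour c q hq (κ v)).toReal

theorem weight_nonneg [NeZero c] (p q : ℝ≥0) (hp : p ≤ 1) (hq : q ≤ 1) (f : Edges a b)
    (κ : Node a b → Option (Fin c)) : 0 ≤ weight p q hp hq f κ := by
  unfold weight
  refine mul_nonneg (Finset.prod_nonneg fun i _ => ENNReal.toReal_nonneg)
    (Finset.prod_nonneg fun v _ => ?_)
  split_ifs
  · exact zero_le_one
  · exact ENNReal.toReal_nonneg

theorem randomRestriction_real [NeZero c] (p q : ℝ≥0) (hp : p ≤ 1) (hq : q ≤ 1)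
    (E : Set (Restriction a b c)) (X : Finset (Edges a b × (Node a b → Option (Fin c))))
    (hX : ∀ s, s ∈ X ↔ Valid s.1 s.2 ∧ toRestriction s.1 s.2 ∈ E) :
    (randomRestriction a b c p q hp hq).toMeasure.real E =
      ∑ s ∈ X, weight p q hp hq s.1 s.2 := by
  classical
  obtain rfl : X = Finset.univ.filter fun s => Valid s.1 s.2 ∧ toRestriction s.1 s.2 ∈ E :=
    Finset.ext fun s => by rw [hX s, Finset.mem_filter, and_iff_right (Finset.mem_univ s)]
  rw [Finset.sum_filter]
  unfold randomRestriction MeasureTheory.Measure.real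
  rw [PMF.toMeasure_bind_apply _ _ _ MeasurableSpace.measurableSet_top, tsum_fintype,
    ENNReal.toReal_sum, Fintype.sum_prod_type]
  swap
  · intro f _
    exact ENNReal.mul_ne_top (PMF.apply_ne_top _ _) (MeasureTheory.measure_ne_top _ _)
  refine Finset.sum_congr rfl fun f _ => ?_
  rw [ENNReal.toReal_mul, piPMF_apply, ENNReal.toReal_prod]
  by_cases hf : InjEdges f
  · let _ : MeasurableSpace (OtherPath f → Option (Fin c)) := ⊤
    rw [PMF.toMeasure_map_apply _ _ _ measurable_from_top MeasurableSpace.measurableSet_top, PMF.toMeasure_apply_fintype,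
      ENNReal.toReal_sum, Finset.mul_sum, ← Finset.sum_filter]
    swap
    · intro κ _
      refine ne_top_of_le_ne_top (PMF.apply_ne_top _ κ) (Set.indicator_le_self' ?_ κ)
      simp
    simp only [Set.indicator_apply, Set.mem_preimage]
    have h1 : ∀ κ : OtherPath f → Option (Fin c),
        (∏ i, (randomInjection b p hp (f i)).toReal) * (if ofColouring f κ ∈ E then
          (piPMF fun _ : OtherPath f => randomColour c q hq) κ else 0).toReal =
        if ofColouring f κ ∈ E then weight p q hp hq f (colourAt f κ) else 0 := by
      intro κ
      split_ifs
      · rw [piPMF_apply, ENNReal.toReal_prod,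
          prod_otherPath hf κ fun t => (randomColour c q hq t).toReal]
        rfl
      · simp
    simp only [h1]
    rw [← Finset.sum_filter]
    refine Finset.sum_bij (fun κ _ => colourAt f κ) ?_ ?_ ?_ ?_
    · intro κ hκ
      simp only [Finset.mem_filter, Finset.mem_univ, true_and] at hκ ⊢
      exact ⟨colourAt_valid hf κ, by rwa [← ofColouring_eq]⟩
    · intro κ _ κ' _ h
      exact colourAt_injective f h
    · intro κ hκ
      simp only [Finset.mem_filter, Finset.mem_univ, true_and] at hκ
      obtain ⟨κ', rfl⟩ := exists_colourAt hκ.1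
      refine ⟨κ', ?_, rfl⟩
      simp only [Finset.mem_filter, Finset.mem_univ, true_and]
      rw [ofColouring_eq]
      exact hκ.2
    · intro κ _
      rfl
  -- Non-injective edges have probability zero and carry no valid colouring, so both sides vanish.
  · rw [Finset.sum_eq_zero]
    · unfold InjEdges at hf
      push Not at hf
      obtain ⟨i, x, x', z, h1, h2, h3⟩ := hf
      rw [Finset.prod_eq_zero (Finset.mem_univ i), zero_mul]
      rw [randomInjection_apply, if_neg]
      intro h
      exact h3 (h x x' z h1 h2)
    · intro κ _
      rw [if_neg]
      exact fun h => hf h.1.inj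

/-! ### Setting one variable: colouring a path -/

/-- Functions `f_i` together with a colouring of the nodes. -/
abbrev State (a b c : ℕ) : Type := Edges a b × (Node a b → Option (Fin c))

/-- `t` arises from `s` by colouring the path through `v₀`. -/
structure ColourStep (v₀ : Node a b) (s t : State a b c) : Prop where
  edges : s.1 = t.1
  valid_left : Valid s.1 s.2
  valid_right : Valid t.1 t.2
  uncoloured : s.2 v₀ = none
  coloured : t.2 v₀ ≠ none
  eq : ∀ v, v ∉ pathOf s.1 v₀ → s.2 v = t.2 v

theorem ColourStep.unique {v₀ : Node a b} {s s' t : State a b c} (h : ColourStep v₀ s t)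
    (h' : ColourStep v₀ s' t) : s = s' := by
  have h1 : s.1 = s'.1 := h.edges.trans h'.edges.symm
  refine Prod.ext h1 (funext fun v => ?_)
  by_cases hv : v ∈ pathOf s.1 v₀
  · rw [h.valid_left.path hv, h.uncoloured]
    rw [h1] at hv
    rw [h'.valid_left.path hv, h'.uncoloured]
  · rw [h.eq v hv]
    rw [h1] at hv
    rw [h'.eq v hv]

/-- The weight is a product over first nodes, and only the factor at the first node of the path
through `v₀` changes, from q to (1-q)/c. That node is not (0,0), as it receives a colour. -/
theorem ColourStep.weight_eq [NeZero c] {p q : ℝ≥0} (hp : p ≤ 1) (hq : q ≤ 1) {v₀ : Node a b}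
    {s t : State a b c} (h : ColourStep v₀ s t) :
    weight p q hp hq s.1 s.2 * ((1 - q) / c) = q * weight p q hp hq t.1 t.2 := by
  classical
  obtain ⟨f, κ⟩ := s
  obtain ⟨f', κ'⟩ := t
  obtain ⟨he, hv, hv', hn, hnn, heq⟩ := h
  simp only at *
  subst he
  obtain ⟨s₀, hs₀, hm⟩ := exists_start f v₀
  have hmem : s₀ ∈ Finset.univ.filter (IsStart f) := by simpa using hs₀
  have ho : ¬ IsOrigin s₀ := fun ho => by
    apply hnn
    rw [← hv'.path hm, hv'.origin _ ho]
  unfold weight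
  rw [← Finset.mul_prod_erase _ _ hmem, ← Finset.mul_prod_erase _ _ hmem, if_neg ho, if_neg ho,
    hv.path hm, hv'.path hm, hn, randomColour_none]
  obtain ⟨y, hy⟩ := Option.ne_none_iff_exists'.1 hnn
  rw [hy, randomColour_some]
  have : ∏ v ∈ (Finset.univ.filter (IsStart f)).erase s₀,
      (if IsOrigin v then (1 : ℝ) else (randomColour c q hq (κ v)).toReal) =
      ∏ v ∈ (Finset.univ.filter (IsStart f)).erase s₀,
      (if IsOrigin v then (1 : ℝ) else (randomColour c q hq (κ' v)).toReal) := by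
    refine Finset.prod_congr rfl fun v hv1 => ?_
    simp only [Finset.mem_erase, Finset.mem_filter, Finset.mem_univ, true_and] at hv1
    rw [heq v]
    intro h2
    exact hv1.1 (hv1.2.eq_of_mem hs₀ (mem_pathOf_trans hv.inj (mem_pathOf_symm h2) hm))
  rw [this]
  ring

/-! ### Setting one variable: adding an edge -/

/-- The node `(i, x)`, for a level `i` above the bottom. -/
def upper (i : Fin (a - 1)) (x : Fin b) : Node a b := (⟨i.val, by omega⟩, x)

/-- The node `(i + 1, z)`, for a level `i` above the bottom. -/
def lower (i : Fin (a - 1)) (z : Fin b) : Node a b := (⟨i.val + 1, by omega⟩, z)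

open Classical in
/-- `f` with the additional edge from `(i, x)` to `(i + 1, z)`. -/
def addEdge (f : Edges a b) (i : Fin (a - 1)) (x z : Fin b) : Edges a b :=
  Function.update f i (Function.update (f i) x (some z))

theorem addEdge_self (f : Edges a b) (i : Fin (a - 1)) (x z : Fin b) :
    addEdge f i x z i x = some z := by
  simp [addEdge]

theorem addEdge_of_ne (f : Edges a b) {i j : Fin (a - 1)} {x x' : Fin b} (z : Fin b)
    (h : ¬ (j = i ∧ x' = x)) : addEdge f i x z j x' = f j x' := by
  unfold addEdge
  by_cases hj : j = i
  · subst hj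
    rw [Function.update_self, Function.update_of_ne fun hx => h ⟨rfl, hx⟩]
  · rw [Function.update_of_ne hj]

theorem step_upper_lower {f : Edges a b} {i : Fin (a - 1)} {x z : Fin b} (h : f i x = some z) :
    Step f (upper i x) (lower i z) := ⟨i, rfl, rfl, h⟩

theorem step_mono {f g : Edges a b} (h : ∀ i x z, f i x = some z → g i x = some z)
    {v w : Node a b} (hs : Step f v w) : Step g v w := by
  obtain ⟨i, h1, h2, h3⟩ := hs
  exact ⟨i, h1, h2, h _ _ _ h3⟩

theorem reach_mono {f g : Edges a b} (h : ∀ i x z, f i x = some z → g i x = some z)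
    {v w : Node a b} (hs : Reach f v w) : Reach g v w :=
  Relation.ReflTransGen.mono (fun _ _ => step_mono h) _ _ hs

theorem pathOf_mono {f g : Edges a b} (h : ∀ i x z, f i x = some z → g i x = some z)
    (v : Node a b) : pathOf f v ⊆ pathOf g v := fun _ hw =>
  hw.imp (reach_mono h) (reach_mono h)

theorem onOrigin_mono {f g : Edges a b} (h : ∀ i x z, f i x = some z → g i x = some z)
    {v : Node a b} (hv : OnOrigin f v) : OnOrigin g v := by
  obtain ⟨w, h1, h2⟩ := hv
  exact ⟨w, pathOf_mono h v h1, h2⟩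

theorem le_addEdge {f : Edges a b} {i : Fin (a - 1)} {x : Fin b} (z : Fin b) (h : f i x = none)
    (j : Fin (a - 1)) (x' z' : Fin b) (hj : f j x' = some z') :
    addEdge f i x z j x' = some z' := by
  rwa [addEdge_of_ne]
  rintro ⟨rfl, rfl⟩
  rw [h] at hj
  cases hj

theorem step_addEdge {f : Edges a b} {i : Fin (a - 1)} {x z : Fin b} {v w : Node a b}
    (h : Step (addEdge f i x z) v w) : Step f v w ∨ (v = upper i x ∧ w = lower i z) := by
  obtain ⟨j, h1, h2, h3⟩ := h
  by_cases hj : j = i ∧ v.2 = x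
  · obtain ⟨rfl, rfl⟩ := hj
    right
    rw [addEdge_self] at h3
    exact ⟨Prod.ext (Fin.ext h1) rfl, Prod.ext (Fin.ext h2) (Option.some.inj h3).symm⟩
  · rw [addEdge_of_ne f z hj] at h3
    exact Or.inl ⟨j, h1, h2, h3⟩

theorem isStart_lower {f : Edges a b} {i : Fin (a - 1)} {x z : Fin b} (h : f i x = none)
    (hinj : InjEdges (addEdge f i x z)) : IsStart f (lower i z) := by
  intro u hu
  have h1 := (step_mono (le_addEdge z h) hu).left_unique hinj
    (step_upper_lower (addEdge_self f i x z))
  subst h1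
  obtain ⟨j, h1, h2, h3⟩ := hu
  have hj : i = j := Fin.ext h1
  subst hj
  change f i x = _ at h3
  rw [h] at h3
  cases h3

theorem isStart_iff_addEdge {f : Edges a b} {i : Fin (a - 1)} {x z : Fin b} (h : f i x = none)
    (hinj : InjEdges (addEdge f i x z)) (v : Node a b) :
    IsStart f v ↔ v = lower i z ∨ IsStart (addEdge f i x z) v := by
  constructor
  · intro hv
    by_cases hvl : v = lower i z
    · exact Or.inl hvl
    · refine Or.inr fun w hw => ?_
      rcases step_addEdge hw with h1 | h1
      · exact hv w h1
      · exact hvl h1.2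
  · rintro (rfl | hv)
    · exact isStart_lower h hinj
    · exact fun w hw => hv w (step_mono (le_addEdge z h) hw)

/-- `t` arises from `s` by setting `f_i(x)` and by colouring the resulting path if one of its two
parts is coloured. -/
structure EdgeStep (i : Fin (a - 1)) (x : Fin b) (s t : State a b c) : Prop where
  unset : s.1 i x = none
  edges : ∃ z, t.1 = addEdge s.1 i x z
  valid_left : Valid s.1 s.2
  valid_right : Valid t.1 t.2
  le : ∀ v, s.2 v = none ∨ s.2 v = t.2 v
  eq : ∀ z, t.1 i x = some z → ∀ v, v ∉ pathOf s.1 (upper i x) → v ∉ pathOf s.1 (lower i z) →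
    s.2 v = t.2 v

theorem EdgeStep.eq_edges {i : Fin (a - 1)} {x : Fin b} {s s' t : State a b c}
    (h : EdgeStep i x s t) (h' : EdgeStep i x s' t) : s.1 = s'.1 := by
  funext j x'
  obtain ⟨z, hz⟩ := h.edges
  obtain ⟨z', hz'⟩ := h'.edges
  by_cases hj : j = i ∧ x' = x
  · obtain ⟨rfl, rfl⟩ := hj
    rw [h.unset, h'.unset]
  · rw [← addEdge_of_ne s.1 z hj, ← hz, hz', addEdge_of_ne s'.1 z' hj]

/-- Removing the edge splits a path in two. Each half was uncoloured or had its present colour, so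
two bits determine the predecessor. -/
theorem EdgeStep.unique {i : Fin (a - 1)} {x z : Fin b} {s s' t : State a b c}
    (hz : t.1 i x = some z) (h : EdgeStep i x s t) (h' : EdgeStep i x s' t)
    (h1 : s.2 (upper i x) = none ↔ s'.2 (upper i x) = none)
    (h2 : s.2 (lower i z) = none ↔ s'.2 (lower i z) = none) : s = s' := by
  have hf := h.eq_edges h'
  have key : ∀ v, (s.2 v = none ↔ s'.2 v = none) → s.2 v = s'.2 v := by
    intro v hv
    by_cases hn : s.2 v = none
    · rw [hn, hv.1 hn]
    · rw [(h.le v).resolve_left hn, (h'.le v).resolve_left fun hh => hn (hv.2 hh)]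
  refine Prod.ext hf (funext fun v => ?_)
  by_cases hv1 : v ∈ pathOf s.1 (upper i x)
  · rw [h.valid_left.path hv1, key _ h1]
    rw [hf] at hv1
    rw [h'.valid_left.path hv1]
  by_cases hv2 : v ∈ pathOf s.1 (lower i z)
  · rw [h.valid_left.path hv2, key _ h2]
    rw [hf] at hv2
    rw [h'.valid_left.path hv2]
  · rw [h.eq z hz v hv1 hv2]
    rw [hf] at hv1 hv2
    rw [h'.eq z hz v hv1 hv2]

-- Joining two paths removes the first node `lower i z`. If the joined path is uncoloured, a factor
-- q is lost. If it is coloured, the lost factor is q when one half was uncoloured and (1-q)/c when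
-- none was; when both were, q² is compared with (1-q)/c, which is `h3`.
open Classical in
theorem EdgeStep.colour_weight_le [NeZero c] {q : ℝ≥0} (hq : q ≤ 1) {i : Fin (a - 1)}
    {x : Fin b} {s t : State a b c} (h : EdgeStep i x s t) {η : ℝ} (h1 : (q : ℝ) ≤ η)
    (h2 : (1 - q : ℝ) / c ≤ η) (h3 : (q : ℝ) * q ≤ η * ((1 - q) / c)) :
    (∏ v ∈ Finset.univ.filter (IsStart s.1),
      if IsOrigin v then 1 else (randomColour c q hq (s.2 v)).toReal) ≤
    η * ∏ v ∈ Finset.univ.filter (IsStart t.1),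
      if IsOrigin v then 1 else (randomColour c q hq (t.2 v)).toReal := by
  obtain ⟨f, κ⟩ := s
  obtain ⟨f', κ'⟩ := t
  obtain ⟨hn, ⟨z, hz⟩, hv, hv', hle, heq⟩ := h
  simp only at *
  subst hz
  have hself := addEdge_self f i x z
  replace heq := heq z hself
  set f' := addEdge f i x z with hf'
  have hmono := le_addEdge z hn
  have hlow : ¬ IsStart f' (lower i z) := fun h => h _ (step_upper_lower hself)
  have hstarts : Finset.univ.filter (IsStart f) =
      insert (lower i z) (Finset.univ.filter (IsStart f')) := by
    ext v
    simp [isStart_iff_addEdge hn hv'.inj v, hf']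
  have hno : ¬ IsOrigin (lower i z : Node a b) := fun h => by
    have := h.1
    simp [lower] at this
  -- `s₀` is the first node of the upper half, hence of the joined path.
  obtain ⟨s₀, hs₀, hr⟩ := exists_start_reach f (upper i x)
  have hm : s₀ ∈ pathOf f (upper i x) := Or.inr hr
  have hs₀' : IsStart f' s₀ := by
    rcases (isStart_iff_addEdge hn hv'.inj s₀).1 hs₀ with h | h
    · exfalso
      have hlev : ∀ v w : Node a b, Reach f v w → v.1.val ≤ w.1.val := by
        intro v w hvw
        induction hvw with
        | refl => exact le_rfl
        | tail _ h2 ih => exact ih.trans (by have := h2.level; omega)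
      have := hlev _ _ hr
      rw [h] at this
      simp [lower, upper] at this
    · exact h
  have hmem : s₀ ∈ Finset.univ.filter (IsStart f') := by simpa using hs₀'
  rw [hstarts, Finset.prod_insert (by simpa using hlow), ← Finset.mul_prod_erase _ _ hmem,
    ← Finset.mul_prod_erase _ _ hmem, if_neg hno]
  have hrest : ∏ v ∈ (Finset.univ.filter (IsStart f')).erase s₀,
      (if IsOrigin v then (1 : ℝ) else (randomColour c q hq (κ v)).toReal) =
      ∏ v ∈ (Finset.univ.filter (IsStart f')).erase s₀,
      (if IsOrigin v then (1 : ℝ) else (randomColour c q hq (κ' v)).toReal) := by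
    refine Finset.prod_congr rfl fun v hv1 => ?_
    simp only [Finset.mem_erase, Finset.mem_filter, Finset.mem_univ, true_and] at hv1
    have hvs : IsStart f v := (isStart_iff_addEdge hn hv'.inj v).2 (Or.inr hv1.2)
    rw [heq v]
    · intro h2
      exact hv1.1 (hvs.eq_of_mem hs₀ (mem_pathOf_trans hv.inj (mem_pathOf_symm h2) hm))
    · intro h2
      have := hvs.eq_of_mem (isStart_lower hn hv'.inj) (mem_pathOf_symm h2)
      exact hlow (this ▸ hv1.2)
  rw [hrest, ← mul_assoc, ← mul_assoc]
  refine mul_le_mul_of_nonneg_right ?_ (Finset.prod_nonneg fun v _ => ?_)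
  swap
  · split_ifs
    · exact zero_le_one
    · exact ENNReal.toReal_nonneg
  have e1 : κ' s₀ = κ' (lower i z) := by
    rw [hv'.path (pathOf_mono hmono _ hm), hv'.step _ _ (step_upper_lower hself)]
  have hl := hle (lower i z)
  rw [← e1] at hl
  have hq0 : (0 : ℝ) ≤ q := q.coe_nonneg
  have hw0 : (0 : ℝ) ≤ (1 - q) / c := div_nonneg (sub_nonneg.2 (by exact_mod_cast hq))
    (Nat.cast_nonneg c)
  split_ifs with ho
  · rw [hv'.origin _ ho] at hl
    rw [or_self_iff.1 hl, randomColour_none]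
    simpa using h1
  · have hl' := hle s₀
    rcases hk : κ' s₀ with _ | y
    · rw [hk] at hl hl'
      rw [or_self_iff.1 hl, or_self_iff.1 hl', randomColour_none]
      exact mul_le_mul_of_nonneg_right h1 hq0
    · rw [hk] at hl hl'
      rcases hl with hl | hl <;> rcases hl' with hl' | hl' <;> rw [hl, hl'] <;>
        simp only [randomColour_none, randomColour_some]
      · exact h3
      · exact mul_le_mul_of_nonneg_right h1 hw0
      · rw [mul_comm]
        exact mul_le_mul_of_nonneg_right h1 hw0
      · exact mul_le_mul_of_nonneg_right h2 hw0

-- If m values are set, one more replaces a factor p by 1-p and divides by the b-m remaining choices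
-- in the falling factorial; b-m is the number of unset values.
open Classical in
theorem randomInjection_update (p : ℝ≥0) (hp : p ≤ 1) {g : Fin b → Option (Fin b)} {x z : Fin b}
    (hx : g x = none) (hinj : ∀ x₁ x₂ z', Function.update g x (some z) x₁ = some z' →
      Function.update g x (some z) x₂ = some z' → x₁ = x₂) :
    (randomInjection b p hp g).toReal * (1 - p) =
      (randomInjection b p hp (Function.update g x (some z))).toReal *
        (p * (Finset.univ.filter fun x' => g x' = none).card) := by
  have hne : ∀ x' z', g x' = some z' → x' ≠ x := by
    rintro x' z' h rfl
    rw [hx] at h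
    cases h
  have hg : ∀ x₁ x₂ z', g x₁ = some z' → g x₂ = some z' → x₁ = x₂ := by
    intro x₁ x₂ z' h1 h2
    refine hinj x₁ x₂ z' ?_ ?_
    · rwa [Function.update_of_ne (hne _ _ h1)]
    · rwa [Function.update_of_ne (hne _ _ h2)]
  rw [randomInjection_apply, randomInjection_apply, if_pos hg, if_pos hinj]
  rw [← Finset.mul_prod_erase _ _ (Finset.mem_univ x),
    ← Finset.mul_prod_erase _ _ (Finset.mem_univ x)]
  have h1 : ∏ x' ∈ Finset.univ.erase x, (if (Function.update g x (some z) x').isSome then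
      1 - (p : ℝ) else p) = ∏ x' ∈ Finset.univ.erase x, (if (g x').isSome then
      1 - (p : ℝ) else p) := by
    refine Finset.prod_congr rfl fun x' hx' => ?_
    rw [Function.update_of_ne (Finset.ne_of_mem_erase hx')]
  have h2 : (Finset.univ.filter fun x' => (Function.update g x (some z) x').isSome = true) =
      insert x (Finset.univ.filter fun x' => (g x').isSome = true) := by
    ext x'
    by_cases h : x' = x
    · subst h; simp
    · simp [h]
  have h3 : (Finset.univ.filter fun x' => g x' = none).card +
      (Finset.univ.filter fun x' => (g x').isSome = true).card = b := by
    have := Finset.card_filter_add_card_filter_not (s := Finset.univ) fun x' => g x' = none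
    simpa [Option.isSome_iff_ne_none] using this
  have h4 : 0 < (Finset.univ.filter fun x' => g x' = none).card :=
    Finset.card_pos.2 ⟨x, by simpa using hx⟩
  rw [h1, h2, Finset.card_insert_of_notMem (by simp [hx]), Nat.descFactorial_succ,
    Function.update_self, hx]
  set u := (Finset.univ.filter fun x' => g x' = none).card
  set m := (Finset.univ.filter fun x' => (g x').isSome = true).card
  have h5 : b - m = u := by omega
  rw [h5, Nat.cast_mul, mul_inv]
  have h6 : (u : ℝ) ≠ 0 := by positivity
  simp only [Option.isSome_none, Option.isSome_some, Bool.false_eq_true, if_false, if_true]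
  field_simp

open Classical in
/-- The number of `x` for which `f_i(x)` is unset. -/
def unsetCard (f : Edges a b) (i : Fin (a - 1)) : ℕ :=
  (Finset.univ.filter fun x => f i x = none).card

theorem EdgeStep.weight_le [NeZero c] {p q : ℝ≥0} (hp : p ≤ 1) (hq : q ≤ 1) {i : Fin (a - 1)}
    {x : Fin b} {s t : State a b c} (h : EdgeStep i x s t) {η : ℝ} (h1 : (q : ℝ) ≤ η)
    (h2 : (1 - q : ℝ) / c ≤ η) (h3 : (q : ℝ) * q ≤ η * ((1 - q) / c)) :
    weight p q hp hq s.1 s.2 * (1 - p) ≤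
      p * unsetCard s.1 i * η * weight p q hp hq t.1 t.2 := by
  classical
  have hcol := h.colour_weight_le hq h1 h2 h3
  obtain ⟨z, hz⟩ := h.edges
  have hprod : (∏ j, (randomInjection b p hp (s.1 j)).toReal) * (1 - p) =
      (∏ j, (randomInjection b p hp (t.1 j)).toReal) * (p * unsetCard s.1 i) := by
    rw [← Finset.mul_prod_erase _ _ (Finset.mem_univ i),
      ← Finset.mul_prod_erase _ _ (Finset.mem_univ i)]
    have hrest : ∏ j ∈ Finset.univ.erase i, (randomInjection b p hp (t.1 j)).toReal =
        ∏ j ∈ Finset.univ.erase i, (randomInjection b p hp (s.1 j)).toReal := by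
      refine Finset.prod_congr rfl fun j hj => ?_
      rw [hz, addEdge, Function.update_of_ne (Finset.ne_of_mem_erase hj)]
    have hi : t.1 i = Function.update (s.1 i) x (some z) := by
      rw [hz, addEdge, Function.update_self]
    have := randomInjection_update p hp h.unset (z := z) (by
      have := h.valid_right.inj i
      rw [hi] at this
      convert this)
    rw [hrest, hi, mul_right_comm]
    unfold unsetCard
    convert congrArg (· * ∏ j ∈ Finset.univ.erase i, (randomInjection b p hp (s.1 j)).toReal) this
      using 1
    ring
  unfold weight
  rw [mul_right_comm, hprod]
  calc _ ≤ (∏ j, (randomInjection b p hp (t.1 j)).toReal) * (p * unsetCard s.1 i) * _ :=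
        mul_le_mul_of_nonneg_left hcol (mul_nonneg
          (Finset.prod_nonneg fun _ _ => ENNReal.toReal_nonneg) (by positivity))
    _ = _ := by ring

/-! ### Total weight of the predecessors of a state -/

/-- `t` arises from `s` by setting the variable `v`. On the level of an edge that is set, at most
`U` values are unset in `s`. -/
def VarStep (U : ℝ) : Var a b c → State a b c → State a b c → Prop
  | .fBit i x _, s, t => EdgeStep i x s t ∧ (unsetCard s.1 i : ℝ) ≤ U
  | .col i x _, s, t => ColourStep (i, x) s t
  | .uBit x _, s, t => ∃ i : Fin a, i.val + 1 = a ∧ ColourStep (i, x) s t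

theorem sum_le_of_unique {S : Type*} [Fintype S] {R : S → Prop} [DecidablePred R] {w : S → ℝ}
    {C : ℝ} (hC : 0 ≤ C) (hu : ∀ s s', R s → R s' → s = s') (hw : ∀ s, R s → w s ≤ C) :
    ∑ s ∈ Finset.univ.filter R, w s ≤ C := by
  have : (Finset.univ.filter R).card ≤ 1 := Finset.card_le_one.2 fun s hs s' hs' =>
    hu s s' (Finset.mem_filter.1 hs).2 (Finset.mem_filter.1 hs').2
  refine (Finset.sum_le_card_nsmul _ _ C fun s hs => hw s (Finset.mem_filter.1 hs).2).trans ?_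
  rw [nsmul_eq_mul]
  exact mul_le_of_le_one_left hC (by exact_mod_cast this)

open Classical in
theorem sum_varStep_le [NeZero c] {p q : ℝ≥0} (hp : p ≤ 1) (hq : q ≤ 1) {U η δ : ℝ}
    (hp1 : (p : ℝ) < 1) (hq1 : (q : ℝ) < 1) (h1 : (q : ℝ) ≤ η)
    (h2 : (1 - q : ℝ) / c ≤ η) (h3 : (q : ℝ) * q ≤ η * ((1 - q) / c))
    (hcol : (q : ℝ) ≤ δ * ((1 - q) / c)) (hedge : 4 * (p * U * η) ≤ δ * (1 - p)) (hδ : 0 ≤ δ)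
    (v : Var a b c) (t : State a b c) :
    ∑ s ∈ Finset.univ.filter (fun s => VarStep U v s t), weight p q hp hq s.1 s.2 ≤
      δ * weight p q hp hq t.1 t.2 := by
  have hwt := weight_nonneg p q hp hq t.1 t.2
  have hc0 : (0 : ℝ) < (1 - q) / c :=
    div_pos (sub_pos.2 hq1) (Nat.cast_pos.2 (Nat.pos_of_ne_zero (NeZero.ne c)))
  have hcs : ∀ v₀ (s : State a b c), ColourStep v₀ s t →
      weight p q hp hq s.1 s.2 ≤ δ * weight p q hp hq t.1 t.2 := by
    intro v₀ s hs
    refine le_of_mul_le_mul_right ?_ hc0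
    rw [hs.weight_eq hp hq]
    calc _ ≤ δ * ((1 - q) / c) * weight p q hp hq t.1 t.2 := mul_le_mul_of_nonneg_right hcol hwt
      _ = _ := by ring
  cases v with
  | fBit i x j =>
    have hη : 0 ≤ η := h1.trans' q.coe_nonneg
    have hb : ∀ s ∈ Finset.univ.filter fun s => EdgeStep i x s t ∧ (unsetCard s.1 i : ℝ) ≤ U,
        weight p q hp hq s.1 s.2 ≤ δ / 4 * weight p q hp hq t.1 t.2 := by
      intro s hs
      simp only [Finset.mem_filter, Finset.mem_univ, true_and] at hs
      refine le_of_mul_le_mul_right ?_ (sub_pos.2 hp1)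
      calc _ ≤ p * unsetCard s.1 i * η * weight p q hp hq t.1 t.2 :=
            hs.1.weight_le hp hq h1 h2 h3
        _ ≤ p * U * η * weight p q hp hq t.1 t.2 := by
            gcongr
            exact hs.2
        _ ≤ δ / 4 * (1 - p) * weight p q hp hq t.1 t.2 :=
            mul_le_mul_of_nonneg_right (by linarith) hwt
        _ = _ := by ring
    -- This count is the source of the 4 in `hedge`: one predecessor for each pair of bits telling
    -- which halves were uncoloured.
    have hcard : (Finset.univ.filter fun s : State a b c => EdgeStep i x s t ∧
        (unsetCard s.1 i : ℝ) ≤ U).card ≤ 4 := by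
      rcases hz : t.1 i x with _ | z
      · rw [Finset.filter_false_of_mem]
        · simp
        · rintro s _ ⟨hs, _⟩
          obtain ⟨z, hz'⟩ := hs.edges
          rw [hz', addEdge_self] at hz
          cases hz
      · refine (Finset.card_le_card_of_injOn (t := (Finset.univ : Finset (Bool × Bool)))
          (fun s => (decide (s.2 (upper i x) = none), decide (s.2 (lower i z) = none)))
          (fun _ _ => Finset.mem_coe.2 (Finset.mem_univ _)) ?_).trans (by simp)
        intro s hs s' hs' h
        simp only [Finset.coe_filter, Finset.mem_univ, true_and, Set.mem_ofPred_eq] at hs hs'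
        simp only [Prod.mk.injEq, decide_eq_decide] at h
        exact hs.1.unique hz hs'.1 h.1 h.2
    have hsum := Finset.sum_le_card_nsmul _ _ _ hb
    rw [nsmul_eq_mul] at hsum
    refine le_trans (le_of_eq (Finset.sum_congr (Finset.ext fun s => ?_) fun _ _ => rfl))
      (hsum.trans ?_)
    · rw [Finset.mem_filter, Finset.mem_filter]
      rfl
    calc _ ≤ (4 : ℝ) * (δ / 4 * weight p q hp hq t.1 t.2) :=
          mul_le_mul_of_nonneg_right (by exact_mod_cast hcard) (by positivity)
      _ = _ := by ring
  | col i x y =>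
    exact sum_le_of_unique (mul_nonneg hδ hwt) (fun s s' hs hs' => ColourStep.unique hs hs')
      fun s hs => hcs _ s hs
  | uBit x j =>
    refine sum_le_of_unique (mul_nonneg hδ hwt) ?_ ?_
    · rintro s s' ⟨i, hi, hs⟩ ⟨i', hi', hs'⟩
      obtain rfl : i = i' := Fin.ext (by omega)
      exact hs.unique hs'
    · rintro s ⟨i, _, hs⟩
      exact hcs _ s hs

/-- `t` arises from `s` by setting some of the variables in the list. -/
def Chain (U : ℝ) : List (Var a b c) → State a b c → State a b c → Prop
  | [], s, t => s = t
  | v :: L, s, t => ∃ r, (s = r ∨ VarStep U v s r) ∧ Chain U L r t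

theorem Chain.refl (U : ℝ) (L : List (Var a b c)) (t : State a b c) : Chain U L t t := by
  induction L with
  | nil => rfl
  | cons v L ih => exact ⟨t, Or.inl rfl, ih⟩

-- Double counting: w(X) is at most the sum over `t` in `Y` of the weight of all `s` related to `t`.
open Classical in
theorem sum_le_of_cover {S : Type*} [Fintype S] {w : S → ℝ} (hw : ∀ s, 0 ≤ w s) {C : ℝ}
    {R : S → S → Prop} {X Y : Finset S} (hX : ∀ s ∈ X, ∃ t ∈ Y, R s t)
    (hR : ∀ t ∈ Y, ∑ s ∈ Finset.univ.filter (fun s => R s t), w s ≤ C * w t) :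
    ∑ s ∈ X, w s ≤ C * ∑ t ∈ Y, w t := by
  rw [Finset.mul_sum]
  refine le_trans ?_ (Finset.sum_le_sum hR)
  simp only [Finset.sum_filter]
  rw [Finset.sum_comm]
  refine (Finset.sum_le_sum fun s hs => ?_).trans
    (Finset.sum_le_sum_of_subset_of_nonneg (Finset.subset_univ X) fun s _ _ =>
      Finset.sum_nonneg fun t _ => ?_)
  · obtain ⟨t, ht, hst⟩ := hX s hs
    refine le_trans ?_ (Finset.single_le_sum (f := fun t => if R s t then w s else 0)
      (fun t _ => ?_) ht)
    · simp [hst]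
    · split_ifs
      · exact hw s
      · exact le_rfl
  · split_ifs
    · exact hw s
    · exact le_rfl

-- Each variable is either skipped, contributing 1, or undone, contributing at most δ.
open Classical in
theorem sum_chain_le {w : State a b c → ℝ} (hw : ∀ s, 0 ≤ w s) {U δ : ℝ} (hδ : 0 ≤ δ)
    (hstep : ∀ v t, ∑ s ∈ Finset.univ.filter (fun s => VarStep U v s t), w s ≤ δ * w t)
    (L : List (Var a b c)) (t : State a b c) :
    ∑ s ∈ Finset.univ.filter (fun s => Chain U L s t), w s ≤ (1 + δ) ^ L.length * w t := by
  induction L with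
  | nil =>
    refine (sum_le_of_unique (R := fun s => Chain U [] s t) (hw t)
      (fun s s' h h' => Eq.trans h (Eq.symm h')) fun s h => (congrArg w h).le).trans (by simp)
  | cons v L ih =>
    have := sum_le_of_cover hw (X := Finset.univ.filter fun s => Chain U (v :: L) s t)
      (Y := Finset.univ.filter fun s => Chain U L s t) (C := 1 + δ)
      (R := fun s r => s = r ∨ VarStep U v s r) ?_ ?_
    · calc _ ≤ (1 + δ) * _ := this
        _ ≤ (1 + δ) * ((1 + δ) ^ L.length * w t) :=
          mul_le_mul_of_nonneg_left ih (by linarith)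
        _ = _ := by rw [List.length_cons]; ring
    · intro s hs
      obtain ⟨r, h1, h2⟩ := (Finset.mem_filter.1 hs).2
      exact ⟨r, by simpa using h2, h1⟩
    · intro r _
      have h1 := sum_le_of_unique (R := fun s => s = r) (hw r)
        (fun s s' h h' => Eq.trans h (Eq.symm h')) fun s h => (congrArg w h).le
      have h2 := hstep v r
      rw [Finset.sum_filter] at h1 h2 ⊢
      rw [one_add_mul]
      refine le_trans ?_ (add_le_add h1 h2)
      rw [← Finset.sum_add_distrib]
      refine Finset.sum_le_sum fun s _ => ?_
      have := hw s
      split_ifs <;> first | linarith | (exfalso; tauto)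

open Classical in
theorem sum_chain_ne_le {w : State a b c → ℝ} (hw : ∀ s, 0 ≤ w s) {U δ : ℝ} (hδ : 0 ≤ δ)
    (hstep : ∀ v t, ∑ s ∈ Finset.univ.filter (fun s => VarStep U v s t), w s ≤ δ * w t)
    (L : List (Var a b c)) (t : State a b c) :
    ∑ s ∈ Finset.univ.filter (fun s => Chain U L s t ∧ s ≠ t), w s ≤
      ((1 + δ) ^ L.length - 1) * w t := by
  have h := sum_chain_le hw hδ hstep L t
  rw [← Finset.add_sum_erase _ _ (show t ∈ _ by simpa using Chain.refl U L t)] at h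
  have he : (Finset.univ.filter fun s => Chain U L s t ∧ s ≠ t) =
      (Finset.univ.filter fun s => Chain U L s t).erase t := by
    ext s
    simp [and_comm]
  rw [he]
  linarith

/-! ### Interpolating between a state and an extension of it -/

/-- Everything that is set in `s` is set in `t`, to the same value. -/
structure SubState (s t : State a b c) : Prop where
  edges : ∀ i x z, s.1 i x = some z → t.1 i x = some z
  colour : ∀ v y, s.2 v = some y → t.2 v = some y

theorem SubState.refl (s : State a b c) : SubState s s := ⟨fun _ _ _ h => h, fun _ _ h => h⟩

theorem SubState.trans {s t r : State a b c} (h : SubState s t) (h' : SubState t r) :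
    SubState s r :=
  ⟨fun _ _ _ h1 => h'.edges _ _ _ (h.edges _ _ _ h1),
    fun _ _ h1 => h'.colour _ _ (h.colour _ _ h1)⟩

theorem SubState.unsetCard_le {s t : State a b c} (h : SubState s t) (i : Fin (a - 1)) :
    unsetCard t.1 i ≤ unsetCard s.1 i := by
  classical
  refine Finset.card_le_card fun x hx => ?_
  simp only [Finset.mem_filter, Finset.mem_univ, true_and] at hx ⊢
  rcases hs : s.1 i x with _ | z
  · rfl
  · rw [h.edges _ _ _ hs] at hx
    cases hx

theorem toRestriction_u {f : Edges a b} {κ : Node a b → Option (Fin c)} {v : Node a b}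
    (hv : IsBottom v) : (toRestriction f κ).u v.2 = κ v := by
  have h : v.1.val + 1 = a := hv
  simp only [toRestriction]
  rw [dif_pos (by omega)]
  congr 1
  exact Prod.ext (Fin.ext (by simp only; omega)) rfl

theorem toRestriction_G_origin {f : Edges a b} {κ : Node a b → Option (Fin c)} {v : Node a b}
    (hv : OnOrigin f v) (y : Fin c) : (toRestriction f κ).G v.1 v.2 y = some false :=
  if_pos hv

theorem toRestriction_G {f : Edges a b} {κ : Node a b → Option (Fin c)} {v : Node a b}
    (hv : ¬ OnOrigin f v) (y : Fin c) :
    (toRestriction f κ).G v.1 v.2 y = (κ v).map fun z => decide (y = z) :=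
  if_neg hv

theorem toRestriction_G_some {f : Edges a b} {κ : Node a b → Option (Fin c)} (h : Valid f κ)
    {v : Node a b} {z : Fin c} (hv : κ v = some z) (y : Fin c) :
    (toRestriction f κ).G v.1 v.2 y = some (decide (y = z)) := by
  rw [toRestriction_G, hv, Option.map_some]
  intro ho
  rw [h.eq_none ho] at hv
  cases hv

/-- `Valid` lets the path through (0,0) reach the bottom, which legality forbids; `hb` excludes
this. -/
theorem isLegal_toRestriction {f : Edges a b} {κ : Node a b → Option (Fin c)} (h : Valid f κ)
    (hb : ∀ v, OnOrigin f v → ¬ IsBottom v) : IsLegal (toRestriction f κ) where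
  inj := h.inj
  path v := by
    change PathUnset _ (pathOf f v) ∨ PathZero _ (pathOf f v) ∨ PathOneColour _ (pathOf f v)
    by_cases ho : OnOrigin f v
    · refine Or.inr (Or.inl ⟨ho, fun w hw => ?_⟩)
      have hw' := (onOrigin_congr h.inj hw).2 ho
      exact ⟨hb w hw', toRestriction_G_origin hw'⟩
    · have hno : ∀ w ∈ pathOf f v, ¬ OnOrigin f w := fun w hw hw' =>
        ho ((onOrigin_congr h.inj hw).1 hw')
      rcases hk : κ v with _ | y
      · refine Or.inl fun w hw => ⟨fun y => ?_, fun hbw => ?_⟩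
        · rw [toRestriction_G (hno w hw), h.path hw, hk]
          rfl
        · rw [toRestriction_u hbw, h.path hw, hk]
      · refine Or.inr (Or.inr ⟨fun w hw hw' => hno w hw (hw'.onOrigin f), y, fun w hw => ?_⟩)
        have hw' := (h.path hw).trans hk
        exact ⟨toRestriction_G_some h hw', fun hbw => by rw [toRestriction_u hbw, hw']⟩

theorem SubState.extends {s t : State a b c} (h : SubState s t) (ht : Valid t.1 t.2) :
    Extends (toRestriction t.1 t.2) (toRestriction s.1 s.2) := by
  refine ⟨h.edges, fun i x y e he => ?_, fun x y he => ?_⟩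
  · by_cases ho : OnOrigin s.1 (i, x)
    · rw [toRestriction_G_origin (v := (i, x)) ho] at he
      rw [toRestriction_G_origin (v := (i, x)) (onOrigin_mono h.edges ho), he]
    · rw [toRestriction_G (v := (i, x)) ho] at he
      obtain ⟨z, hz, hz'⟩ := Option.map_eq_some_iff.1 he
      rw [toRestriction_G_some (v := (i, x)) ht (h.colour _ _ hz), ← hz']
  · simp only [toRestriction] at he ⊢
    split_ifs at he ⊢
    exact h.colour _ _ he

/-- The part of a state to which the variable `v` refers is set. -/
def Handled (g : Edges a b) : Var a b c → State a b c → Prop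
  | .fBit i x _, s => s.1 i x ≠ none
  | .col i x _, s => s.2 (i, x) ≠ none ∨ OnOrigin g (i, x)
  | .uBit x _, s => ∀ i : Fin a, i.val + 1 = a → s.2 (i, x) ≠ none

theorem Handled.mono {g : Edges a b} {v : Var a b c} {s t : State a b c} (h : Handled g v s)
    (hst : SubState s t) : Handled g v t := by
  have hc : ∀ w, s.2 w ≠ none → t.2 w ≠ none := by
    intro w hw
    obtain ⟨y, hy⟩ := Option.ne_none_iff_exists'.1 hw
    rw [hst.colour _ _ hy]
    exact Option.some_ne_none y
  cases v with
  | fBit i x j =>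
    obtain ⟨z, hz⟩ := Option.ne_none_iff_exists'.1 h
    change t.1 i x ≠ none
    rw [hst.edges _ _ _ hz]
    exact Option.some_ne_none z
  | col i x y => exact Or.imp_left (hc _) h
  | uBit x j => exact fun i hi => hc _ (h i hi)

/-- The whole path through `v₀` takes the colour it has in `T`, where it lies inside a single path.
-/
theorem exists_colourStep {s T : State a b c} (hs : Valid s.1 s.2) (hT : Valid T.1 T.2)
    (hsT : SubState s T) {v₀ : Node a b} (h : s.2 v₀ = none) (h' : T.2 v₀ ≠ none) :
    ∃ r, ColourStep v₀ s r ∧ SubState s r ∧ SubState r T := by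
  classical
  obtain ⟨y, hy⟩ := Option.ne_none_iff_exists'.1 h'
  have hpath : ∀ v ∈ pathOf s.1 v₀, T.2 v = some y := fun v hv => by
    rw [hT.path (pathOf_mono hsT.edges _ hv), hy]
  have hval : Valid s.1 (fun v => if v ∈ pathOf s.1 v₀ then some y else s.2 v) := by
    refine ⟨hs.inj, fun v w hvw => ?_, fun v hv => ?_⟩
    · have : v ∈ pathOf s.1 v₀ ↔ w ∈ pathOf s.1 v₀ :=
        ⟨fun h1 => mem_pathOf_trans hs.inj h1 hvw.mem_pathOf,
          fun h1 => mem_pathOf_trans hs.inj h1 (mem_pathOf_symm hvw.mem_pathOf)⟩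
      simp only [this, hs.step v w hvw]
    · rw [if_neg, hs.origin v hv]
      intro h1
      have := hpath v h1
      rw [hT.origin v hv] at this
      cases this
  refine ⟨(s.1, fun v => if v ∈ pathOf s.1 v₀ then some y else s.2 v),
    ⟨rfl, hs, hval, h, ?_, fun v hv => (if_neg hv).symm⟩, ⟨fun _ _ _ h1 => h1, fun v y' h1 => ?_⟩,
    ⟨hsT.edges, fun v y' h1 => ?_⟩⟩
  · simp [mem_pathOf_self]
  · dsimp only
    rw [if_neg, h1]
    intro h2
    rw [hs.path h2, h] at h1
    cases h1
  · dsimp only at h1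
    split_ifs at h1 with h2
    · rw [hpath v h2, h1]
    · exact hsT.colour _ _ h1

theorem exists_edgeStep {s T : State a b c} (hs : Valid s.1 s.2) (hT : Valid T.1 T.2)
    (hsT : SubState s T) {i : Fin (a - 1)} {x : Fin b} (h : s.1 i x = none)
    (h' : T.1 i x ≠ none) :
    ∃ r, EdgeStep i x s r ∧ SubState s r ∧ SubState r T := by
  classical
  obtain ⟨z, hz⟩ := Option.ne_none_iff_exists'.1 h'
  have hmono := le_addEdge z h
  have hle : ∀ j x' z', addEdge s.1 i x z j x' = some z' → T.1 j x' = some z' := by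
    intro j x' z' hj
    by_cases hji : j = i ∧ x' = x
    · obtain ⟨rfl, rfl⟩ := hji
      rw [addEdge_self] at hj
      rw [hz, hj]
    · rw [addEdge_of_ne s.1 z hji] at hj
      exact hsT.edges _ _ _ hj
  have hTe : T.2 (upper i x) = T.2 (lower i z) := hT.step _ _ (step_upper_lower hz)
  have hTu : ∀ v, v ∈ pathOf s.1 (upper i x) ∨ v ∈ pathOf s.1 (lower i z) →
      T.2 v = T.2 (upper i x) := by
    rintro v (hv | hv)
    · exact hT.path (pathOf_mono hsT.edges _ hv)
    · rw [hTe]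
      exact hT.path (pathOf_mono hsT.edges _ hv)
  -- The joined path keeps whichever colour its halves have. Two colours cannot clash, since both
  -- agree with `T`; if neither half is coloured, none is added.
  obtain ⟨m, hm⟩ : ∃ m, m = (s.2 (upper i x)).or (s.2 (lower i z)) := ⟨_, rfl⟩
  have hmT : ∀ y, m = some y → T.2 (upper i x) = some y := by
    intro y hy
    rw [hy] at hm
    rcases Option.or_eq_some_iff.1 hm.symm with h1 | h1
    · exact hsT.colour _ _ h1
    · rw [hTe]
      exact hsT.colour _ _ h1.2
  have hle2 : ∀ v, v ∈ pathOf s.1 (upper i x) ∨ v ∈ pathOf s.1 (lower i z) →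
      ∀ y, s.2 v = some y → m = some y := by
    intro v hv y hy
    have h1 : T.2 (upper i x) = some y := by rw [← hTu v hv, hsT.colour _ _ hy]
    have h2 : m ≠ none := by
      intro h2
      rw [h2] at hm
      have h3 := Option.or_eq_none_iff.1 hm.symm
      rcases hv with hv | hv
      · rw [hs.path hv, h3.1] at hy
        cases hy
      · rw [hs.path hv, h3.2] at hy
        cases hy
    obtain ⟨y', hy'⟩ := Option.ne_none_iff_exists'.1 h2
    rw [hy', ← hmT y' hy', h1]
  have hval : Valid (addEdge s.1 i x z) (fun v => if v ∈ pathOf s.1 (upper i x) ∨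
      v ∈ pathOf s.1 (lower i z) then m else s.2 v) := by
    refine ⟨fun j x₁ x₂ z' h1 h2 => hT.inj j x₁ x₂ z' (hle _ _ _ h1) (hle _ _ _ h2),
      fun v w hvw => ?_, fun v hv => ?_⟩
    · rcases step_addEdge hvw with h1 | ⟨rfl, rfl⟩
      · have : ∀ u, v ∈ pathOf s.1 u ↔ w ∈ pathOf s.1 u := fun u =>
          ⟨fun h2 => mem_pathOf_trans hs.inj h2 h1.mem_pathOf,
            fun h2 => mem_pathOf_trans hs.inj h2 (mem_pathOf_symm h1.mem_pathOf)⟩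
        simp only [this, hs.step v w h1]
      · simp [mem_pathOf_self]
    · split_ifs with h1
      · rcases hm' : m with _ | y
        · rfl
        · have := hmT y hm'
          rw [← hTu v h1, hT.origin v hv] at this
          cases this
      · exact hs.origin v hv
  refine ⟨(addEdge s.1 i x z, fun v => if v ∈ pathOf s.1 (upper i x) ∨
      v ∈ pathOf s.1 (lower i z) then m else s.2 v),
    ⟨h, ⟨z, rfl⟩, hs, hval, fun v => ?_, fun z' hz' v h1 h2 => ?_⟩,
    ⟨hmono, fun v y h1 => ?_⟩, ⟨hle, fun v y h1 => ?_⟩⟩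
  · dsimp only
    split_ifs with h1
    · rcases hsv : s.2 v with _ | y
      · exact Or.inl rfl
      · exact Or.inr (hle2 v h1 y hsv).symm
    · exact Or.inr rfl
  · dsimp only at hz' ⊢
    rw [addEdge_self] at hz'
    obtain rfl := Option.some.inj hz'
    rw [if_neg (not_or.2 ⟨h1, h2⟩)]
  · dsimp only
    split_ifs with h2
    · exact hle2 v h2 y h1
    · exact h1
  · dsimp only at h1
    split_ifs at h1 with h2
    · rw [hTu v h2, hmT y h1]
    · exact hsT.colour _ _ h1

theorem exists_varStep {s T : State a b c} (hs : Valid s.1 s.2) (hT : Valid T.1 T.2)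
    (hsT : SubState s T) {U : ℝ} (hU : ∀ i, (unsetCard s.1 i : ℝ) ≤ U) (v : Var a b c)
    (hv : Handled T.1 v T) :
    ∃ r, (s = r ∨ VarStep U v s r) ∧ Valid r.1 r.2 ∧ SubState s r ∧ SubState r T ∧
      Handled T.1 v r := by
  by_cases hh : Handled T.1 v s
  · exact ⟨s, Or.inl rfl, hs, SubState.refl s, hsT, hh⟩
  cases v with
  | fBit i x j =>
    have h1 : s.1 i x = none := not_ne_iff.1 hh
    obtain ⟨r, hr, h2, h3⟩ := exists_edgeStep hs hT hsT h1 hv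
    refine ⟨r, Or.inr ⟨hr, hU i⟩, hr.valid_right, h2, h3, ?_⟩
    obtain ⟨z, hz⟩ := hr.edges
    change r.1 i x ≠ none
    rw [hz, addEdge_self]
    exact Option.some_ne_none z
  | col i x y =>
    have h1 := not_or.1 hh
    obtain ⟨r, hr, h2, h3⟩ := exists_colourStep hs hT hsT (not_ne_iff.1 h1.1)
      (hv.resolve_right h1.2)
    exact ⟨r, Or.inr hr, hr.valid_right, h2, h3, Or.inl hr.coloured⟩
  | uBit x j =>
    simp only [Handled] at hh
    push Not at hh
    obtain ⟨i, hi, h1⟩ := hh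
    obtain ⟨r, hr, h2, h3⟩ := exists_colourStep hs hT hsT h1 (hv i hi)
    refine ⟨r, Or.inr ⟨i, hi, hr⟩, hr.valid_right, h2, h3, fun i' hi' => ?_⟩
    obtain rfl : i = i' := Fin.ext (by omega)
    exact hr.coloured

/-- The variables are set one at a time as in `T`. The bound `U` persists because the number of
unset values only decreases. -/
theorem exists_chain {T : State a b c} (hT : Valid T.1 T.2) {U : ℝ} (L : List (Var a b c))
    (hL : ∀ v ∈ L, Handled T.1 v T) {s : State a b c} (hs : Valid s.1 s.2) (hsT : SubState s T)
    (hU : ∀ i, (unsetCard s.1 i : ℝ) ≤ U) :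
    ∃ t, Chain U L s t ∧ Valid t.1 t.2 ∧ SubState s t ∧ SubState t T ∧
      ∀ v ∈ L, Handled T.1 v t := by
  induction L generalizing s with
  | nil => exact ⟨s, rfl, hs, SubState.refl s, hsT, by simp⟩
  | cons v L ih =>
    obtain ⟨r, h1, h2, h3, h4, h5⟩ := exists_varStep hs hT hsT hU v (hL v List.mem_cons_self)
    obtain ⟨t, g1, g2, g3, g4, g5⟩ := ih (fun w hw => hL w (List.mem_cons_of_mem v hw)) h2 h4
      fun i => (hU i).trans' (by exact_mod_cast h3.unsetCard_le i)
    refine ⟨t, ⟨r, h1, g1⟩, g2, h3.trans g3, g4, fun w hw => ?_⟩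
    rcases List.mem_cons.1 hw with rfl | hw
    · exact h5.mono g3
    · exact g5 w hw

/-! ### Falsifying a clause by setting only its own variables -/

theorem IsLegal.G_eq {σ : Restriction a b c} (h : IsLegal σ) {v w : Node a b}
    (hw : w ∈ pathOf σ.f v) : σ.G w.1 w.2 = σ.G v.1 v.2 := by
  funext y
  have hv := mem_pathOf_self σ.f v
  rcases h.path v with h1 | h1 | ⟨_, z, h1⟩
  · rw [(h1 w hw).1, (h1 v hv).1]
  · rw [(h1.2 w hw).2, (h1.2 v hv).2]
  · rw [(h1 w hw).1, (h1 v hv).1]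

theorem IsLegal.G_of_true {σ : Restriction a b c} (h : IsLegal σ) {v : Node a b} {y : Fin c}
    (hy : σ.G v.1 v.2 y = some true) :
    (∀ w ∈ pathOf σ.f v, ¬ IsOrigin w) ∧ ∀ y', σ.G v.1 v.2 y' = some (decide (y' = y)) := by
  have hv := mem_pathOf_self σ.f v
  rcases h.path v with h1 | h1 | ⟨h0, z, h1⟩
  · rw [(h1 v hv).1] at hy
    cases hy
  · rw [(h1.2 v hv).2] at hy
    cases hy
  · have := hy
    rw [(h1 v hv).1] at this
    obtain rfl : y = z := by simpa using this
    exact ⟨h0, (h1 v hv).1⟩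

/-- `T` keeps from `σ` only the edges set in `s` or queried by `D`, and colours every path except
the one through (0,0). The last clause says that falsity of `D` depends only on the parts of `T`
that `D` queries, so other colours may be dropped. -/
theorem exists_target [NeZero a] [NeZero c] {s : State a b c} (hs : Valid s.1 s.2) {σ : Restriction a b c}
    (hσ : IsLegal σ) (hext : Extends σ (toRestriction s.1 s.2)) {D : Clause a b c}
    (hD : ∀ l ∈ D, σ.value l.1 = some (!l.2)) (hcard : D.card < c) :
    ∃ T : State a b c, Valid T.1 T.2 ∧ SubState s T ∧
      (∀ v, OnOrigin T.1 v → ¬ IsBottom v) ∧ (∀ l ∈ D, Handled T.1 l.1 T) ∧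
      (∀ i x, T.1 i x ≠ none → s.1 i x ≠ none ∨ ∃ l ∈ D, ∃ j, l.1 = .fBit i x j) ∧
      ∀ κ, SubState (T.1, κ) T → (∀ l ∈ D, Handled T.1 l.1 (T.1, κ)) →
        ∀ l ∈ D, (toRestriction T.1 κ).value l.1 = some (!l.2) := by
  classical
  obtain ⟨f, κ₀⟩ := s
  simp only at hs hext ⊢
  obtain ⟨hef, heG, heu⟩ := hext
  change ∀ i x z, f i x = some z → σ.f i x = some z at hef
  -- A path of `T` may be a fragment cut off from the path of `σ` through (0,0), where every G-value
  -- is 0. Such a path needs a colour in `T`; one not mentioned by `D` is harmless, and exists since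
  -- |D| < c.
  obtain ⟨y₀, hy₀⟩ : ∃ y₀ : Fin c, ∀ l ∈ D, ∀ i x, l.1 ≠ .col i x y₀ := by
    let g : Literal a b c → Fin c := fun l => match l.1 with
      | .col _ _ y => y
      | _ => 0
    have : ((D.image g).card) < (Finset.univ : Finset (Fin c)).card := by
      rw [Finset.card_univ, Fintype.card_fin]
      exact Finset.card_image_le.trans_lt hcard
    obtain ⟨y₀, _, hy⟩ := Finset.exists_mem_notMem_of_card_lt_card this
    refine ⟨y₀, fun l hl i x h => hy (Finset.mem_image.2 ⟨l, hl, ?_⟩)⟩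
    simp only [g, h]
  set f₁ : Edges a b := fun i x =>
    if f i x ≠ none ∨ ∃ l ∈ D, ∃ j, l.1 = Var.fBit i x j then σ.f i x else none with hf₁
  have hf1 : ∀ i x z, f i x = some z → f₁ i x = some z := by
    intro i x z h
    rw [hf₁]
    simp only
    rw [if_pos (Or.inl (by rw [h]; exact Option.some_ne_none z)), hef _ _ _ h]
  have h1σ : ∀ i x z, f₁ i x = some z → σ.f i x = some z := by
    intro i x z h
    rw [hf₁] at h
    simp only at h
    split_ifs at h
    exact h
  have hinj1 : InjEdges f₁ := fun i x x' z h h' => hσ.inj i x x' z (h1σ _ _ _ h) (h1σ _ _ _ h')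
  let cg : (Fin c → Option Bool) → Option (Fin c) := fun g =>
    if h : ∃ y, g y = some true then some h.choose else some y₀
  let κ₁ : Node a b → Option (Fin c) := fun v =>
    if OnOrigin f₁ v then none else cg (σ.G v.1 v.2)
  have hcg : ∀ (v : Node a b) y, σ.G v.1 v.2 y = some true → cg (σ.G v.1 v.2) = some y := by
    intro v y h
    have h1 : ∃ y, σ.G v.1 v.2 y = some true := ⟨y, h⟩
    change dite _ _ _ = _
    rw [dif_pos h1]
    have := h1.choose_spec
    rw [(hσ.G_of_true h).2] at this
    simpa using this
  have hnotrue : ∀ (v : Node a b) y, σ.G v.1 v.2 y = some true → ¬ OnOrigin f₁ v := by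
    intro v y h ho
    obtain ⟨w, hw, hw'⟩ := onOrigin_mono h1σ ho
    exact (hσ.G_of_true h).1 w hw hw'
  have hκ1 : ∀ (v : Node a b) y, σ.G v.1 v.2 y = some true → κ₁ v = some y := by
    intro v y h
    change ite _ _ _ = _
    rw [if_neg (hnotrue v y h), hcg v y h]
  -- The restriction of `s` already sets G to 0 at (0,0), so `σ` cannot leave this path unset.
  have hzero : ∀ v, OnOrigin f₁ v → PathZero σ (pathOf σ.f v) := by
    intro v ho
    obtain ⟨w, hw, hw'⟩ := onOrigin_mono h1σ ho
    rcases hσ.path v with h | h | h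
    · have h2 := heG w.1 w.2 0 false (toRestriction_G_origin (hw'.onOrigin f) 0)
      rw [(h w hw).1] at h2
      cases h2
    · exact h
    · exact absurd hw' (h.1 w hw)
  -- In a legal restriction a set value of u forces a properly coloured path, so `y₀` never
  -- conflicts with u.
  have hubot : ∀ x j e, σ.value (.uBit x j) = some e → ∀ i : Fin a, i.val + 1 = a →
      ∃ y, σ.u x = some y ∧ κ₁ (i, x) = some y := by
    intro x j e he i hi
    obtain ⟨y, hy, _⟩ := Option.map_eq_some_iff.1 he
    refine ⟨y, hy, ?_⟩
    have hv := mem_pathOf_self σ.f (i, x)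
    rcases hσ.path (i, x) with h | h | ⟨_, z, h⟩
    · have := (h _ hv).2 hi
      simp only at this
      rw [hy] at this
      cases this
    · exact absurd hi (h.2 _ hv).1
    · have h2 := (h _ hv).2 hi
      simp only at h2
      rw [hy] at h2
      obtain rfl := Option.some.inj h2
      exact hκ1 _ _ (by rw [(h _ hv).1]; simp)
  have hval : Valid f₁ κ₁ := by
    refine ⟨hinj1, fun v w hvw => ?_, fun v hv => if_pos (hv.onOrigin f₁)⟩
    change ite _ _ _ = ite _ _ _
    rw [hσ.G_eq (pathOf_mono h1σ _ hvw.mem_pathOf)]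
    simp only [onOrigin_congr hinj1 hvw.mem_pathOf]
  have hfull : ∀ v, κ₁ v ≠ none ∨ OnOrigin f₁ v := by
    intro v
    by_cases h : OnOrigin f₁ v
    · exact Or.inr h
    · left
      change ite _ _ _ ≠ _
      rw [if_neg h]
      change dite _ _ _ ≠ _
      split_ifs <;> exact Option.some_ne_none _
  have hedge : ∀ l ∈ D, ∀ i x j, l.1 = Var.fBit i x j → f₁ i x = σ.f i x :=
    fun l hl i x j h => if_pos (Or.inr ⟨l, hl, j, h⟩)
  refine ⟨(f₁, κ₁), hval, ⟨hf1, fun v y h => ?_⟩, fun v ho hb => ?_, fun l hl => ?_,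
    fun i x h => ?_, fun κ hκ hh l hl => ?_⟩
  · refine hκ1 v y (heG v.1 v.2 y true ?_)
    rw [toRestriction_G_some hs h]
    simp
  · exact ((hzero v ho).2 v (mem_pathOf_self _ _)).1 hb
  · have hDl := hD l hl
    rcases hl1 : l.1 with ⟨i, x, j⟩ | ⟨i, x, y⟩ | ⟨x, j⟩
    · rw [hl1] at hDl
      obtain ⟨z, hz, _⟩ := Option.map_eq_some_iff.1 hDl
      change f₁ i x ≠ none
      rw [hedge l hl i x j hl1, hz]
      exact Option.some_ne_none z
    · exact hfull _
    · rw [hl1] at hDl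
      intro i hi
      obtain ⟨y, _, hy⟩ := hubot x j _ hDl i hi
      change κ₁ (i, x) ≠ none
      rw [hy]
      exact Option.some_ne_none y
  · by_contra hcon
    exact h (if_neg hcon)
  · have hDl := hD l hl
    have hhl := hh l hl
    rcases hl1 : l.1 with ⟨i, x, j⟩ | ⟨i, x, y⟩ | ⟨x, j⟩
    · rw [← hDl, hl1]
      simp only [Restriction.value, toRestriction]
      rw [hedge l hl i x j hl1]
    · rw [hl1] at hDl hhl
      change σ.G i x y = _ at hDl
      change (toRestriction f₁ κ).G i x y = _
      by_cases ho : OnOrigin f₁ (i, x)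
      · rw [toRestriction_G_origin (v := (i, x)) ho, ← hDl]
        exact (((hzero _ ho).2 _ (mem_pathOf_self _ _)).2 y).symm
      · obtain ⟨z, hz⟩ := Option.ne_none_iff_exists'.1 (hhl.resolve_right ho)
        have hz1 : κ₁ (i, x) = some z := hκ.colour _ _ hz
        change κ (i, x) = some z at hz
        rw [toRestriction_G (v := (i, x)) ho, hz, Option.map_some]
        -- Either `σ` assigns the colour and `T` copies it, or the colour is `y₀`; then G is 0 at
        -- the queried `y` in both.
        by_cases hex : ∃ y', σ.G i x y' = some true
        · obtain ⟨y', hy'⟩ := hex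
          have h2 := hκ1 (i, x) y' hy'
          rw [hz1] at h2
          obtain rfl := Option.some.inj h2
          rw [← hDl]
          exact ((hσ.G_of_true (v := (i, x)) hy').2 y).symm
        · have h2 : κ₁ (i, x) = some y₀ := by
            change ite _ _ _ = _
            rw [if_neg ho]
            exact dif_neg hex
          rw [hz1] at h2
          obtain rfl := Option.some.inj h2
          have h3 : y ≠ z := by
            rintro rfl
            exact hy₀ l hl i x hl1
          rcases hb : l.2 with _ | _
          · exact absurd ⟨y, by rw [hDl, hb]; rfl⟩ hex
          · simp [h3]
    · rw [hl1] at hDl hhl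
      obtain ⟨i, hi⟩ : ∃ i : Fin a, i.val + 1 = a :=
        ⟨⟨a - 1, Nat.sub_lt (NeZero.pos a) one_pos⟩, Nat.sub_add_cancel (NeZero.pos a)⟩
      obtain ⟨y, hy, hy'⟩ := hubot x j _ hDl i hi
      obtain ⟨z, hz⟩ := Option.ne_none_iff_exists'.1 (hhl i hi)
      have hz1 := hκ.colour _ _ hz
      simp only at hz hz1
      rw [hy'] at hz1
      obtain rfl := Option.some.inj hz1
      rw [← hDl]
      change Option.map _ ((toRestriction f₁ κ).u x) = Option.map _ (σ.u x)
      rw [toRestriction_u (v := (i, x)) hi, hz, hy]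

theorem exists_extension [NeZero a] [NeZero c] {s : State a b c} (hs : Valid s.1 s.2) {σ : Restriction a b c}
    (hσ : IsLegal σ) (hext : Extends σ (toRestriction s.1 s.2)) {D : Clause a b c}
    (hD : ∀ l ∈ D, σ.value l.1 = some (!l.2)) (hcard : D.card < c) {U : ℝ}
    (hU : ∀ i, (unsetCard s.1 i : ℝ) ≤ U) :
    ∃ t : State a b c, Chain U (D.toList.map Prod.fst) s t ∧ Valid t.1 t.2 ∧
      IsLegal (toRestriction t.1 t.2) ∧
      Extends (toRestriction t.1 t.2) (toRestriction s.1 s.2) ∧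
      ∀ l ∈ D, (toRestriction t.1 t.2).value l.1 = some (!l.2) := by
  obtain ⟨T, hT, hsT, hbot, hhT, hedge, hval⟩ := exists_target hs hσ hext hD hcard
  obtain ⟨t, h1, h2, h3, h4, h5⟩ := exists_chain hT (D.toList.map Prod.fst) (fun v hv => by
    obtain ⟨l, hl, rfl⟩ := List.mem_map.1 hv
    exact hhT l (Finset.mem_toList.1 hl)) hs hsT hU
  have hht : ∀ l ∈ D, Handled T.1 l.1 t := fun l hl =>
    h5 _ (List.mem_map.2 ⟨l, Finset.mem_toList.2 hl, rfl⟩)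
  -- Every edge of `T` was in `s` or is queried by `D`, so the chain ends with exactly the edges of
  -- `T`; this transfers legality of the path through (0,0).
  have hf : t.1 = T.1 := by
    funext i x
    rcases ht : t.1 i x with _ | z
    · by_contra hne
      rcases hedge i x (Ne.symm hne) with h | ⟨l, hl, j, hlj⟩
      · obtain ⟨z, hz⟩ := Option.ne_none_iff_exists'.1 h
        rw [h3.edges _ _ _ hz] at ht
        cases ht
      · have := hht l hl
        rw [hlj] at this
        exact this ht
    · exact (h4.edges _ _ _ ht).symm
  obtain ⟨f, κ⟩ := t
  simp only at hf
  subst hf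
  exact ⟨_, h1, h2, isLegal_toRestriction h2 hbot, h3.extends h2, hval κ h4 hht⟩

/-! ### The weighted counting argument -/

theorem Extends.trans {ρ σ τ : Restriction a b c} (h : Extends τ σ) (h' : Extends σ ρ) :
    Extends τ ρ :=
  ⟨fun i x z hz => h.1 i x z (h'.1 i x z hz), fun i x y e he => h.2.1 i x y e (h'.2.1 i x y e he),
    fun x y hy => h.2.2 x y (h'.2.2 x y hy)⟩

theorem Extends.value {ρ σ : Restriction a b c} (h : Extends σ ρ) {v : Var a b c} {e : Bool}
    (hv : ρ.value v = some e) : σ.value v = some e := by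
  cases v with
  | fBit i x j =>
    obtain ⟨z, hz, hz'⟩ := Option.map_eq_some_iff.1 hv
    exact Option.map_eq_some_iff.2 ⟨z, h.1 i x z hz, hz'⟩
  | col i x y => exact h.2.1 i x y e hv
  | uBit x j =>
    obtain ⟨z, hz, hz'⟩ := Option.map_eq_some_iff.1 hv
    exact Option.map_eq_some_iff.2 ⟨z, h.2.2 x z hz, hz'⟩

/-- This keeps the extended state inside the conditioning event. -/
theorem Extends.fixesTo {ρ σ : Restriction a b c} (h : Extends σ ρ) {B : CNF a b c} {e : Bool}
    (hB : FixesTo ρ B e) : FixesTo σ B e := by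
  cases e with
  | false =>
    obtain ⟨D, hD, hl⟩ := hB
    exact ⟨D, hD, fun l hlD => h.value (hl l hlD)⟩
  | true => exact fun τ hτ hτσ => hB τ hτ (hτσ.trans h)

-- Each unfixed `s` is sent to an extension `t` falsifying the first possible clause. As `t` reveals
-- that clause, no union over the clauses of `B` is needed, and the number of clauses does not
-- enter.
open Classical in
theorem sum_not_fixes_le [NeZero a] [NeZero c] {w : State a b c → ℝ} (hw : ∀ s, 0 ≤ w s)
    {U δ : ℝ} (hδ : 0 ≤ δ)
    (hstep : ∀ v t, ∑ s ∈ Finset.univ.filter (fun s => VarStep U v s t), w s ≤ δ * w t)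
    {k m : ℕ} (hk : k < c) (A : Fin m → CNF a b c) (e : Fin m → Bool) {B : CNF a b c}
    (hB : IsKCNF k B) :
    ∑ s ∈ Finset.univ.filter (fun s : State a b c => Valid s.1 s.2 ∧
        (∀ i, (unsetCard s.1 i : ℝ) ≤ U) ∧ (∀ i, FixesTo (toRestriction s.1 s.2) (A i) (e i)) ∧
        ¬ Fixes (toRestriction s.1 s.2) B), w s ≤
      ((1 + δ) ^ k - 1) * ∑ s ∈ Finset.univ.filter (fun s : State a b c => Valid s.1 s.2 ∧
        ∀ i, FixesTo (toRestriction s.1 s.2) (A i) (e i)), w s := by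
  let fals : Restriction a b c → Clause a b c → Prop := fun σ D =>
    ∀ l ∈ D, σ.value l.1 = some (!l.2)
  let idx : Clause a b c → ℕ := fun D => B.toList.idxOf D
  let first : State a b c → Clause a b c → Prop := fun t D =>
    D ∈ B ∧ fals (toRestriction t.1 t.2) D ∧
      ∀ D' ∈ B, fals (toRestriction t.1 t.2) D' → idx D ≤ idx D'
  have huniq : ∀ t D D', first t D → first t D' → D = D' := by
    intro t D D' h h'
    have : idx D = idx D' := le_antisymm (h.2.2 D' h'.1 h'.2.1) (h'.2.2 D h.1 h.2.1)
    exact (List.idxOf_inj (Finset.mem_toList.2 h.1)).1 this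
  refine sum_le_of_cover hw
    (R := fun s t => ∃ D, first t D ∧ Chain U (D.toList.map Prod.fst) s t ∧ s ≠ t) ?_ ?_
  · intro s hs
    obtain ⟨hval, hU, hA, hfix⟩ := (Finset.mem_filter.1 hs).2
    have h0 : ¬ Falsifies (toRestriction s.1 s.2) B := fun h => hfix ⟨false, h⟩
    have h1 : ∃ σ, IsLegal σ ∧ Extends σ (toRestriction s.1 s.2) ∧ Falsifies σ B := by
      by_contra hcon
      push Not at hcon
      exact hfix ⟨true, hcon⟩
    obtain ⟨σ, hσ, hext, D₀, hD₀, hf₀⟩ := h1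
    obtain ⟨D, hD, hmin⟩ := Finset.exists_min_image (B.filter fun D => ∃ σ, IsLegal σ ∧
      Extends σ (toRestriction s.1 s.2) ∧ fals σ D) idx
      ⟨D₀, Finset.mem_filter.2 ⟨hD₀, σ, hσ, hext, hf₀⟩⟩
    obtain ⟨hDB, σ', hσ', hext', hf'⟩ := Finset.mem_filter.1 hD
    obtain ⟨t, g1, g2, g3, g4, g5⟩ := exists_extension hval hσ' hext' hf'
      ((hB D hDB).trans_lt hk) hU
    refine ⟨t, Finset.mem_filter.2 ⟨Finset.mem_univ _, g2, fun i => g4.fixesTo (hA i)⟩,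
      D, ⟨hDB, g5, fun D' hD' hf => ?_⟩, g1, ?_⟩
    -- The new restriction is itself a legal extension of `s`, so any clause it falsifies competed
    -- in the choice of `D`.
    · exact hmin D' (Finset.mem_filter.2 ⟨hD', _, g3, g4, hf⟩)
    · rintro rfl
      exact h0 ⟨D, hDB, g5⟩
  · intro t _
    by_cases hD : ∃ D, first t D
    · obtain ⟨D, hD⟩ := hD
      have hlen : (D.toList.map Prod.fst).length ≤ k := by
        rw [List.length_map, Finset.length_toList]
        exact hB D hD.1
      calc _ = ∑ s ∈ Finset.univ.filter
            (fun s => Chain U (D.toList.map Prod.fst) s t ∧ s ≠ t), w s := by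
            refine Finset.sum_congr (Finset.filter_congr fun s _ => ?_) fun _ _ => rfl
            constructor
            · rintro ⟨D', h1, h2⟩
              rwa [huniq t D D' hD h1]
            · exact fun h => ⟨D, hD, h⟩
        _ ≤ _ := sum_chain_ne_le hw hδ hstep _ t
        _ ≤ _ := mul_le_mul_of_nonneg_right
            (sub_le_sub_right (pow_le_pow_right₀ (by linarith) hlen) 1) (hw t)
    · rw [Finset.filter_false_of_mem]
      · rw [Finset.sum_empty]
        exact mul_nonneg (sub_nonneg.2 (one_le_pow₀ (by linarith))) (hw t)
      · rintro s _ ⟨D, h, _⟩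
        exact hD ⟨D, h⟩

/-! ### Parameters and conclusion -/

theorem cond_real {Ω : Type*} [MeasurableSpace Ω] (μ : MeasureTheory.Measure Ω) {S : Set Ω}
    (hS : MeasurableSet S) (T : Set Ω) :
    (ProbabilityTheory.cond μ S).real T = (μ.real S)⁻¹ * μ.real (S ∩ T) := by
  unfold MeasureTheory.Measure.real
  rw [ProbabilityTheory.cond_apply hS, ENNReal.toReal_mul, ENNReal.toReal_inv]

theorem one_add_pow_sub_one_le {δ : ℝ} (hδ : 0 ≤ δ) {k : ℕ} (h : k * δ ≤ 1) :
    (1 + δ) ^ k - 1 ≤ 2 * (k * δ) := by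
  have h0 : 0 ≤ k * δ := by positivity
  have h1 : (1 + δ) ^ k ≤ Real.exp (k * δ) := by
    rw [Real.exp_nat_mul]
    exact pow_le_pow_left₀ (by linarith) (by linarith [Real.add_one_le_exp δ]) k
  have h2 := Real.abs_exp_sub_one_le (x := k * δ) (by rwa [abs_of_nonneg h0])
  rw [abs_of_nonneg h0] at h2
  linarith [le_abs_self (Real.exp (k * δ) - 1)]

theorem natCast_rpow_div_seven (n j : ℕ) :
    (n : ℝ) ^ (-(j / 7) : ℝ) = (((n : ℝ) ^ (1 / 7 : ℝ)) ^ j)⁻¹ := by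
  rw [Real.rpow_neg (Nat.cast_nonneg n), ← Real.rpow_natCast, ← Real.rpow_mul (Nat.cast_nonneg n)]
  congr 2
  ring

theorem law_real_not_fixes_le {n c : ℕ} [NeZero c] {K N : ℝ} (hK : 1 < K)
    (hN : N = (n : ℝ) ^ (1 / 7 : ℝ)) (hNK : 8 * K ≤ N) (hc : c = ⌊N⌋₊) {k m : ℕ}
    (A : Fin m → CNF n n c) (e : Fin m → Bool) {B : CNF n n c} (hB : IsKCNF k B)
    (hk : 12 * (k : ℝ) ≤ N) :
    (law n c).real ({ρ | IsGood K ρ ∧ ∀ i, FixesTo ρ (A i) (e i)} ∩ {ρ | ¬ Fixes ρ B}) ≤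
      4 * k / N * (law n c).real {ρ | ∀ i, FixesTo ρ (A i) (e i)} := by
  classical
  have hN8 : 8 ≤ N := by linarith
  have hN0 : 0 < N := by linarith
  have hn : n ≠ 0 := by
    rintro rfl
    rw [Nat.cast_zero, Real.zero_rpow (by norm_num)] at hN
    linarith
  have : NeZero n := ⟨hn⟩
  have hcN : (c : ℝ) ≤ N := hc ▸ Nat.floor_le hN0.le
  have hNc : N < c + 1 := hc ▸ Nat.lt_floor_add_one N
  have hkc : k < c := by
    have : (k : ℝ) < c := by linarith
    exact_mod_cast this
  have hn7 : (n : ℝ) = N ^ 7 := by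
    rw [hN, ← Real.rpow_natCast, ← Real.rpow_mul (Nat.cast_nonneg n)]
    norm_num
  have hp : (pPar n : ℝ) = (N ^ 4)⁻¹ := by
    rw [hN, ← natCast_rpow_div_seven, pPar, NNReal.coe_rpow, NNReal.coe_natCast]
    norm_num
  have hq : (qPar n : ℝ) = (N ^ 2)⁻¹ := by
    rw [hN, ← natCast_rpow_div_seven, qPar, NNReal.coe_rpow, NNReal.coe_natCast]
    norm_num
  have hq2 : (qPar n : ℝ) ≤ 1 / 2 := by
    rw [hq, inv_le_comm₀ (by positivity) (by norm_num)]
    nlinarith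
  have hp2 : (pPar n : ℝ) ≤ 1 / 2 := by
    rw [hp, inv_le_comm₀ (by positivity) (by norm_num)]
    have : (8 : ℝ) ^ 4 ≤ N ^ 4 := pow_le_pow_left₀ (by norm_num) hN8 4
    linarith
  have hc0 : (0 : ℝ) < c := by linarith
  have hqc : (N * 2)⁻¹ ≤ (1 - qPar n) / c := by
    rw [mul_inv, mul_comm, div_eq_mul_inv]
    exact mul_le_mul (by norm_num1; linarith) (inv_anti₀ hc0 hcN) (by positivity) (by linarith)
  have hcol : (qPar n : ℝ) ≤ 2 / N * ((1 - qPar n) / c) := by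
    refine le_trans (le_of_eq ?_) (mul_le_mul_of_nonneg_left hqc (by positivity))
    rw [hq]
    field_simp
  -- `U` is the upper bound on unset values from goodness. Both δ and η are 2/N: the factors 2
  -- absorb 1-q and 1-p, each at least 1/2.
  have hsum := sum_not_fixes_le (w := fun s : State n n c =>
    weight (pPar n) (qPar n) (pPar_le_one n) (qPar_le_one n) s.1 s.2)
    (fun s => weight_nonneg _ _ _ _ _ _) (U := K * (pPar n * n)) (δ := 2 / N) (by positivity)
    (sum_varStep_le (η := 2 / N) _ _ (by linarith) (by linarith) ?_ ?_ ?_ hcol ?_ (by positivity))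
    hkc A e hB
  rotate_left
  · rw [hq, inv_le_comm₀ (by positivity) (by positivity), inv_div]
    nlinarith
  · rw [div_le_div_iff₀ hc0 hN0]
    have : (0 : ℝ) ≤ qPar n := (qPar n).coe_nonneg
    nlinarith
  · refine le_trans ?_ hcol
    exact mul_le_of_le_one_left (qPar n).coe_nonneg (by linarith)
  -- Here p²n = 1/N. The threshold 8K ≤ N is what brings this down to 1/N.
  · have h1 : 4 * ((pPar n : ℝ) * (K * (pPar n * n)) * (2 / N)) = 8 * K / N ^ 2 := by
      rw [hp, hn7]
      field_simp
      ring
    rw [h1]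
    calc 8 * K / N ^ 2 ≤ N / N ^ 2 := by gcongr
      _ = 2 / N * (1 / 2) := by field_simp
      _ ≤ _ := by
        gcongr
        linarith
  have hpow := one_add_pow_sub_one_le (δ := 2 / N) (by positivity) (k := k) (by
    rw [mul_div_assoc', div_le_one hN0]
    linarith [Nat.cast_nonneg (α := ℝ) k])
  unfold law
  rw [randomRestriction_real _ _ _ _ _ (Finset.univ.filter fun s : State n n c =>
      Valid s.1 s.2 ∧ (IsGood K (toRestriction s.1 s.2) ∧
        ∀ i, FixesTo (toRestriction s.1 s.2) (A i) (e i)) ∧ ¬ Fixes (toRestriction s.1 s.2) B)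
      fun s => by rw [Finset.mem_filter, and_iff_right (Finset.mem_univ s)]; rfl,
    randomRestriction_real _ _ _ _ _ (Finset.univ.filter fun s : State n n c =>
      Valid s.1 s.2 ∧ ∀ i, FixesTo (toRestriction s.1 s.2) (A i) (e i))
      fun s => by rw [Finset.mem_filter, and_iff_right (Finset.mem_univ s)]; rfl]
  refine le_trans (Finset.sum_le_sum_of_subset_of_nonneg (fun s hs => ?_)
    fun s _ _ => weight_nonneg _ _ _ _ _ _) (hsum.trans ?_)
  · obtain ⟨h1, ⟨h2, h3⟩, h4⟩ := (Finset.mem_filter.1 hs).2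
    refine Finset.mem_filter.2 ⟨Finset.mem_univ _, h1, fun i => ?_, h3, h4⟩
    have h5 := h2.unset_le i
    have h6 : ({x | (toRestriction s.1 s.2).f i x = none} : Set (Fin n)).ncard =
        unsetCard s.1 i := by
      unfold unsetCard
      rw [← Set.ncard_coe_finset]
      congr 1
      ext x
      simp [toRestriction]
    rwa [h6] at h5
  · refine mul_le_mul (hpow.trans (le_of_eq (by ring)))
      (Finset.sum_le_sum_of_subset_of_nonneg
        (fun s hs => Finset.mem_filter.2 (Finset.mem_filter.1 hs))
        fun s _ _ => weight_nonneg _ _ _ _ _ _)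
      (Finset.sum_nonneg fun s _ => weight_nonneg _ _ _ _ _ _) (by positivity)

end CPLS

end

theorem mainTheorem6 (K : ℝ) (hK : 1 < K) :
    ∃ n₀ : ℕ, ∀ (n c : ℕ) [NeZero c], n₀ ≤ n →
      (∃ r, n = 2 ^ r) → (∃ s, c = 2 ^ s) → c = ⌊(n : ℝ) ^ (1 / 7 : ℝ)⌋₊ →
      ∀ (k m : ℕ) (A : Fin m → CPLS.CNF n n c) (e : Fin m → Bool) (B : CPLS.CNF n n c),
        1 ≤ k → (∀ i, CPLS.IsKCNF k (A i)) → CPLS.IsKCNF k B →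
        (ProbabilityTheory.cond (CPLS.law n c) {ρ | ∀ i, CPLS.FixesTo ρ (A i) (e i)}).real
            {ρ | ¬ CPLS.IsGood K ρ} < 1 / 2 →
        (ProbabilityTheory.cond (CPLS.law n c)
              {ρ | CPLS.IsGood K ρ ∧ ∀ i, CPLS.FixesTo ρ (A i) (e i)}).real
            {ρ | ¬ CPLS.Fixes ρ B} < 12 * (k : ℝ) * (n : ℝ) ^ (-(1 / 7) : ℝ) := by
  -- This threshold is equivalent to 8K ≤ N for N = n^{1/7}.
  refine ⟨⌈(8 * K) ^ 7⌉₊, fun n c _ hn _ _ hc k m A e B hk _ hB hbad => ?_⟩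
  obtain ⟨N, hN⟩ : ∃ N, N = (n : ℝ) ^ (1 / 7 : ℝ) := ⟨_, rfl⟩
  have hNK : 8 * K ≤ N := by
    have h1 : (8 * K) ^ 7 ≤ (n : ℝ) := Nat.ceil_le.1 hn
    rw [hN]
    calc 8 * K = ((8 * K) ^ 7) ^ (1 / 7 : ℝ) := by
          rw [← Real.rpow_natCast, ← Real.rpow_mul (by linarith)]
          norm_num
      _ ≤ _ := Real.rpow_le_rpow (by positivity) h1 (by norm_num)
  have hN0 : 0 < N := by linarith
  have hpow : (n : ℝ) ^ (-(1 / 7) : ℝ) = N⁻¹ := by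
    rw [hN, Real.rpow_neg (Nat.cast_nonneg n)]
  rw [← hN] at hc
  rw [hpow]
  have hk1 : (1 : ℝ) ≤ k := by exact_mod_cast hk
  have hprob : MeasureTheory.IsProbabilityMeasure (CPLS.law n c) := by
    unfold CPLS.law
    infer_instance
  rw [CPLS.cond_real _ MeasurableSpace.measurableSet_top] at hbad ⊢
  set F := {ρ : CPLS.Restriction n n c | ∀ i, CPLS.FixesTo ρ (A i) (e i)} with hF
  set S := {ρ : CPLS.Restriction n n c | CPLS.IsGood K ρ ∧ ∀ i, CPLS.FixesTo ρ (A i) (e i)} with hS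
  by_cases hbig : 12 * (k : ℝ) ≤ N
  · have hmain := CPLS.law_real_not_fixes_le hK hN hNK hc A e hB hbig
    rw [← hF, ← hS] at hmain
    have hsplit : (CPLS.law n c).real F ≤
        (CPLS.law n c).real (F ∩ {ρ | ¬ CPLS.IsGood K ρ}) + (CPLS.law n c).real S := by
      refine (MeasureTheory.measureReal_mono (fun ρ hρ => ?_)).trans
        (MeasureTheory.measureReal_union_le _ _)
      by_cases hg : CPLS.IsGood K ρ
      · exact Or.inr ⟨hg, hρ⟩
      · exact Or.inl ⟨hρ, hg⟩
    -- If the conditioning event is null, the conditional probability is 0 by convention, and the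
    -- bound is positive.
    rcases (MeasureTheory.measureReal_nonneg (μ := CPLS.law n c) (s := S)).eq_or_lt with h0 | h0
    · rw [← h0, inv_zero, zero_mul]
      positivity
    · have hF0 : 0 < (CPLS.law n c).real F :=
        h0.trans_le (MeasureTheory.measureReal_mono fun ρ hρ => hρ.2)
      rw [inv_mul_lt_iff₀ hF0] at hbad
      rw [inv_mul_lt_iff₀ h0]
      calc _ ≤ 4 * k / N * (CPLS.law n c).real F := hmain
        _ ≤ 4 * k / N * (2 * (CPLS.law n c).real S) := by
            gcongr
            linarith
        _ = (CPLS.law n c).real S * (8 * k * N⁻¹) := by ring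
        _ < _ := by
            gcongr
            norm_num
  -- For 12k > N the claimed bound exceeds 1.
  · have h1 : ((CPLS.law n c).real S)⁻¹ * (CPLS.law n c).real (S ∩ {ρ | ¬ CPLS.Fixes ρ B}) ≤ 1 :=
      inv_mul_le_one_of_le₀ (MeasureTheory.measureReal_mono Set.inter_subset_left)
        MeasureTheory.measureReal_nonneg
    refine h1.trans_lt ?_
    rw [← div_eq_mul_inv, lt_div_iff₀ hN0]
    linarith
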